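/- Let $R$ be a commutative local domain of Krull dimension $1$ with field of fractions $Q$, and let $\overline R$ be the integral closure of $R$ in $Q$. The rank of an $R$-module $M$ is $\dim_Q(M\otimes_R Q)$, and a module is called indecomposable if it is non-zero and is not a direct sum of two non-zero submodules. (A) If $\overline R$ is a valuation ring, then every finitely generated torsion-free $R$-module is a direct sum of modules with local endomorphism rings. (B) Assume in addition that $R$ is noetherian. Then the following statements are equivalent: (1) every direct summand of a direct sum of finitely generated torsion-free $R$-modules of rank one is a direct sum of finitely generated modules; (1') the class of direct sums of finitely generated torsion-free $R$-modules of rank one is closed under direct summands; (2) for every finitely generated torsion-free $R$-module $M$ of rank one, every direct summand of $R^{(\omega)}\oplus M$ is a direct sum of finitely generated modules; (3) every finitely generated torsion-free $R$-module of rank one has local endomorphism ring; (4) $\overline R$ is a local ring; (4') $\overline R$ is a discrete valuation ring; (5) every direct summand of a direct sum of finitely generated torsion-free $R$-modules is a direct sum of finitely generated modules; (5') the class $\mathcal F$ of direct sums of finitely generated torsion-free $R$-modules is closed under direct summands; (6) for every finitely generated torsion-free $R$-module $M$, every direct summand of $R^{(\omega)}\oplus M$ is a direct sum of finitely generated modules;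 (7) every finitely generated indecomposable torsion-free $R$-module has local endomorphism ring. Here direct sums may be infinite, over index sets of arbitrary cardinality, and $R^{(\omega)}$ is the free module on a countably infinite basis. -/

import Mathlib

universe u v

/-- `M` is the (internal) direct sum of a family, of arbitrary cardinality, of submodules each of
which has the property `P`.  The empty family is allowed and gives the zero module. -/
def IsDirectSumOf (R : Type u) [CommRing R] (M : Type v) [AddCommGroup M] [Module R M]
    (P : Submodule R M → Prop) : Prop :=
  ∃ (ι : Type v) (_ : DecidableEq ι) (N : ι → Submodule R M),
    DirectSum.IsInternal N ∧ ∀ i, P (N i)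

/-- `M` is a direct sum of finitely generated modules. -/
def IsDirectSumFG (R : Type u) [CommRing R] (M : Type v) [AddCommGroup M] [Module R M] : Prop :=
  IsDirectSumOf R M fun N => Module.Finite R N

/-- `M` is a direct sum of finitely generated torsion-free modules. -/
def IsDirectSumFGTorsionFree (R : Type u) [CommRing R]
    (M : Type v) [AddCommGroup M] [Module R M] : Prop :=
  IsDirectSumOf R M fun N => Module.Finite R N ∧ Module.IsTorsionFree R N

/-- `M` is a direct sum of finitely generated torsion-free modules of rank one.  (Over a domain with
field of fractions `Q`, `Module.finrank R N` is the `Q`-dimension of `Q ⊗[R] N`; see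
`finrank_fractionRing_tensor` below.) -/
def IsDirectSumFGTorsionFreeRankOne (R : Type u) [CommRing R]
    (M : Type v) [AddCommGroup M] [Module R M] : Prop :=
  IsDirectSumOf R M fun N =>
    Module.Finite R N ∧ Module.IsTorsionFree R N ∧ Module.finrank R N = 1

/-- `M` is a direct sum of modules with local endomorphism ring. -/
def IsDirectSumLocalEnd (R : Type u) [CommRing R]
    (M : Type v) [AddCommGroup M] [Module R M] : Prop :=
  IsDirectSumOf R M fun N => IsLocalRing (Module.End R N)

/-- A module is indecomposable if it is nonzero and is not the direct sum of two nonzero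
submodules. -/
def IsIndecomposableModule (R : Type u) [CommRing R]
    (M : Type v) [AddCommGroup M] [Module R M] : Prop :=
  Nontrivial M ∧ ∀ A B : Submodule R M, IsCompl A B → A = ⊥ ∨ B = ⊥

open scoped TensorProduct in
/-- The rank of a module over a domain is the dimension of its extension to the field of
fractions. -/
theorem finrank_fractionRing_tensor (R : Type u) [CommRing R] [IsDomain R]
    (Q : Type v) [Field Q] [Algebra R Q] [IsFractionRing R Q]
    (M : Type u) [AddCommGroup M] [Module R M] :
    Module.finrank Q (Q ⊗[R] M) = Module.finrank R M := by
  have : FaithfulSMul R Q := IsFractionRing.instFaithfulSMul R Q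
  exact (TensorProduct.isBaseChange R M Q).finrank_eq

/-! Suppose the integral closure V is a valuation ring. A finitely generated torsion-free module M
embeds in some Vⁿ so that it contains the standard basis, and the coordinates occurring lie in a
subalgebra S of V that is finite over R, local, and satisfies rS ⊆ R for some nonzero nonunit r of
R. Hence End M lies in the matrix ring Mₙ(S) and contains r Mₙ(S). As R has dimension one, every
endomorphism, being integral over R, is strongly π-regular modulo r. The resulting idempotent modulo
r lifts to Mₙ(S), because S is local, and the lift stays in End M. So End M is an exchange ring
(`isExchangeRing_end`). An exchange ring without nontrivial idempotents is local, and induction on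
the rank splits M into summands with local endomorphism rings.

Exchange also controls summands of infinite direct sums. An element of a summand lies in a finitely
generated summand of it, which settles countably generated summands; Kaplansky's dévissage reduces
the general case to these (`Submodule.decomposesInto_fg_of_isComplemented`). For rank one, a summand
with local endomorphism ring embeds into one of the given modules. Over a noetherian R, the
Krull–Akizuki argument turns a local integral closure into a discrete valuation ring.

Conversely, let the integral closure be non-local, with maximal ideals P₀ and P₁ containing α and 1
- α. In S = R[α], a finitely generated module of rank one, there is an element a with a ∈ P₀, a ≡ 1
modulo P₁ and (a² - a)S ⊆ R. It is the corner S → S of an idempotent E of R^(ω) ⊕ S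
(`exists_idempotent_end_finsupp_prod`). If the range of E were a direct sum of finitely generated
modules, a would be a finite sum of corners of idempotents with finitely generated range, each 0
modulo P₀. Such a corner is also 0 modulo P₁, as comparing determinants of the pencil (1 - M) + XM
at the two places shows (`not_map_corner_eq_of_finite_range`). This contradicts a ≡ 1. -/

/-! ### Integral elements modulo r, and exchange rings -/

open Polynomial in
/-- An integral element `A` of an algebra over a one-dimensional domain is, modulo a nonzero
scalar, strongly `π`-regular; we record the resulting idempotent modulo `r`. -/
theorem IsIntegral.exists_idempotent_mod {R : Type*} [CommRing R] [IsDomain R]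
    [Ring.DimensionLEOne R] {T : Type*} [Ring T] [Algebra R T] {A : T} (hA : IsIntegral R A)
    {r : R} (hr : r ≠ 0) :
    ∃ (t w : R[X]) (y z : T),
      (aeval A t * A) * (aeval A t * A) - aeval A t * A = r • y ∧
      1 - aeval A t * A - aeval A w * (1 - A) = r • z := by
  obtain ⟨p, hp, hpA⟩ := hA
  have hpA' : aeval A p = 0 := hpA
  have : Module.Finite R (AdjoinRoot p) := hp.finite_adjoinRoot
  have : Algebra.IsIntegral R (AdjoinRoot p) := inferInstance
  -- Otherwise some prime P contains r and avoids all a ^ k * (1 - a * s). It meets R in a nonzero,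
  -- hence maximal, ideal, so P is maximal by integrality; but then a is invertible modulo P, which
  -- puts some 1 - a * s into P.
  obtain ⟨k, s, hks⟩ : ∃ (k : ℕ) (s : AdjoinRoot p),
      AdjoinRoot.root p ^ k * (1 - AdjoinRoot.root p * s) ∈
        Ideal.span {algebraMap R (AdjoinRoot p) r} := by
    by_contra! hcon
    set a := AdjoinRoot.root p
    let S : Submonoid (AdjoinRoot p) :=
      { carrier := {x | ∃ k s, x = a ^ k * (1 - a * s)}
        one_mem' := ⟨0, 0, by simp⟩
        mul_mem' := by
          rintro _ _ ⟨k, s, rfl⟩ ⟨l, s', rfl⟩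
          exact ⟨k + l, s + s' - a * s * s', by ring⟩ }
    obtain ⟨P, hP, hle, hdis⟩ := Ideal.exists_le_prime_disjoint
      (Ideal.span {algebraMap R (AdjoinRoot p) r}) S (by
        rw [Set.disjoint_left]
        rintro x hx ⟨k, s, rfl⟩
        exact hcon k s hx)
    rw [Set.disjoint_left] at hdis
    have hrP : r ∈ P.comap (algebraMap R (AdjoinRoot p)) :=
      hle (Ideal.subset_span rfl)
    have : (P.comap (algebraMap R (AdjoinRoot p))).IsMaximal :=
      Ring.DimensionLEOne.maximalOfPrime (fun h => hr (by rwa [h] at hrP)) inferInstance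
    have hPm : P.IsMaximal := Ideal.isMaximal_of_isIntegral_of_isMaximal_comap P this
    have haP : a ∉ P := fun h => hdis h ⟨1, 0, by simp⟩
    obtain ⟨s, hs⟩ := hPm.exists_inv haP
    obtain ⟨i, hi, hs⟩ := hs
    refine hdis (a := 1 - a * s) ?_ ⟨0, s, by simp⟩
    have : 1 - a * s = i := by rw [← hs]; ring
    rwa [this]
  obtain ⟨d, hd⟩ := Ideal.mem_span_singleton'.mp hks
  obtain ⟨s, rfl⟩ := AdjoinRoot.mk_surjective s
  obtain ⟨d, rfl⟩ := AdjoinRoot.mk_surjective d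
  have hdvd : p ∣ X ^ k * (1 - X * s) - d * C r := by
    rw [← AdjoinRoot.mk_eq_zero, map_sub, sub_eq_zero]
    simp only [map_mul, map_pow, map_sub, map_one, AdjoinRoot.mk_X, AdjoinRoot.mk_C]
    exact hd.symm
  obtain ⟨q, hq⟩ := hdvd
  have key : ∀ f : R[X], aeval A (f * (X ^ k * (1 - X * s))) = r • aeval A (f * d) := by
    intro f
    have : f * (X ^ k * (1 - X * s)) = C r * (f * d) + f * q * p := by
      linear_combination f * hq
    rw [this, map_add, map_mul _ _ p, hpA', mul_zero, add_zero, ← smul_eq_C_mul, map_smul]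
  -- The idempotent is f = (X s)ⁿ. As n = k + 1, it is a multiple of X with cofactor X ^ k * s ^ n,
  -- and both f(1 - f) and (1 - f)Xⁿ are multiples of X ^ k * (1 - X s). The factor `h` accounts for
  -- 1 - Xⁿ being a multiple of 1 - X.
  set n := k + 1
  have hgeom : 1 - (X * s) ^ n = (∑ i ∈ Finset.range n, (X * s) ^ i) * (1 - X * s) :=
    (geom_sum_mul_neg _ _).symm
  set g := ∑ i ∈ Finset.range n, (X * s) ^ i
  have hgeomX : (1 : R[X]) - X ^ n = (∑ i ∈ Finset.range n, X ^ i) * (1 - X) :=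
    (geom_sum_mul_neg _ _).symm
  set h : R[X] := ∑ i ∈ Finset.range n, X ^ i
  have hn : (X : R[X]) ^ n = X ^ k * X := pow_succ _ _
  have hns : (X * s) ^ n = X ^ k * X * s ^ n := by rw [mul_pow, hn]
  refine ⟨X ^ k * s ^ n, (1 - X ^ n * s ^ n) * h, aeval A (-(X * s ^ n * g) * d),
    aeval A (X * g * d), ?_, ?_⟩
  · have e1 : aeval A (X ^ k * s ^ n) * A = aeval A ((X ^ k * s ^ n) * X) := by simp
    rw [e1, ← map_mul, ← map_sub, ← key]
    congr 1
    rw [hns] at hgeom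
    linear_combination (-(X ^ k * s ^ n * X)) * hgeom
  · have e1 : aeval A (X ^ k * s ^ n) * A = aeval A ((X ^ k * s ^ n) * X) := by simp
    have e2 : aeval A ((1 - X ^ n * s ^ n) * h) * (1 - A) =
      aeval A ((1 - X ^ n * s ^ n) * h * (1 - X)) := by simp
    rw [e1, e2, ← key, ← map_one (aeval (R := R) A), ← map_sub, ← map_sub]
    congr 1
    rw [hns] at hgeom
    rw [hn] at hgeomX ⊢
    linear_combination (1 - X ^ k * X * s ^ n) * hgeomX + X ^ k * X * hgeom

/-- Every element `a` splits an idempotent `f ∈ Ta` off with `1 - f ∈ T(1 - a)`. -/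
def IsExchangeRing (T : Type*) [Ring T] : Prop :=
  ∀ a : T, ∃ f s w : T, IsIdempotentElem f ∧ f = s * a ∧ 1 - f = w * (1 - a)

/-- An exchange ring without nontrivial idempotents is local. -/
theorem IsExchangeRing.isLocalRing {T : Type*} [Ring T] [Nontrivial T] (hT : IsExchangeRing T)
    (h : ∀ e : T, IsIdempotentElem e → e = 0 ∨ e = 1) : IsLocalRing T := by
  have unit_of_left : ∀ s a : T, s * a = 1 → IsUnit a := by
    intro s a hsa
    have : IsIdempotentElem (a * s) := by
      unfold IsIdempotentElem
      rw [mul_assoc, ← mul_assoc s, hsa, one_mul]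
    rcases h _ this with h0 | h1
    · exfalso
      have : s * (a * s) * a = 1 := by rw [← mul_assoc, hsa, one_mul, hsa]
      rw [h0] at this
      simp at this
    · exact ⟨⟨a, s, h1, hsa⟩, rfl⟩
  refine IsLocalRing.of_isUnit_or_isUnit_one_sub_self fun a => ?_
  obtain ⟨f, s, w, hf, hs, hw⟩ := hT a
  rcases h f hf with h0 | h1
  · right
    exact unit_of_left w _ (by rw [← hw, h0, sub_zero])
  · left
    exact unit_of_left s _ (by rw [← hs, h1])

/-- Transfer of the exchange property: `T` sits in `W` and contains `r W`, idempotents lift modulo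
`r` in `W`, and elements of `T` are strongly `π`-regular modulo `r`. -/
theorem IsExchangeRing.of_lifting {R T W : Type*} [CommRing R] [Ring T] [Ring W] [Algebra R T]
    [Algebra R W] (φ : T →ₐ[R] W) (hφ : Function.Injective φ) (r : R)
    (hr : ∀ x : W, ∃ y : T, φ y = r • x)
    (hunit : ∀ x : W, IsUnit (1 + r • x))
    (hlift : ∀ x y : W, x * x - x = r • y → ∃ e z : W, IsIdempotentElem e ∧ e = x + r • z)
    (hreg : ∀ a : T, ∃ t w y z : T, (t * a) * (t * a) - t * a = r • y ∧
      1 - t * a - w * (1 - a) = r • z) : IsExchangeRing T := by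
  intro a
  obtain ⟨t, w, y, z, hy, hz⟩ := hreg a
  obtain ⟨e', z', he', hez'⟩ := hlift (φ (t * a)) (φ y) (by
    rw [← map_mul, ← map_sub, hy, map_smul])
  obtain ⟨j, hj⟩ := hr z'
  obtain ⟨e, he⟩ : ∃ e : T, e = t * a + j := ⟨_, rfl⟩
  have hφe : φ e = e' := by rw [he, map_add, hj, hez']
  have hide : IsIdempotentElem e := hφ (by rw [map_mul, hφe]; exact he')
  -- U is congruent to 1 modulo r, while e U ∈ T a and (1 - e) U ∈ T (1 - a). Thus U⁻¹ e U is an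
  -- idempotent of T a whose complement lies in T (1 - a).
  set U := e * (t * a) + (1 - e) * (w * (1 - a))
  have hU : U = 1 - e * j - (1 - e) * (r • z - j) := by
    have h1 : t * a = e - j := by rw [he]; abel
    have h2 : w * (1 - a) = 1 - e - (r • z - j) := by
      rw [← hz, he]; abel
    simp only [U, h2]
    rw [h1, mul_sub, hide, mul_sub (1 - e) (1 - e)]
    have : (1 - e) * (1 - e) = 1 - e := hide.one_sub
    rw [this]; abel
  obtain ⟨x, hx⟩ : ∃ x : W, φ U = 1 + r • x := by
    refine ⟨-(e' * z') - (1 - e') * (φ z - z'), ?_⟩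
    rw [hU]
    simp only [map_sub, map_mul, map_one, hφe, hj, map_smul, mul_smul_comm, smul_sub, smul_neg,
      mul_sub]
    abel
  obtain ⟨x', hx'⟩ := hunit x
  -- The inverse of 1 + r x is 1 - r x (1 + r x)⁻¹, so it again comes from T.
  obtain ⟨v, hv⟩ := hr (-(x * (↑x'⁻¹ : W)))
  have hinv : (↑x'⁻¹ : W) = φ (1 + v) := by
    rw [map_add, map_one, hv, smul_neg, ← smul_mul_assoc]
    have : r • x = x' - 1 := by rw [hx']; abel
    rw [this, sub_mul, Units.mul_inv, one_mul]; abel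
  have hUl : (1 + v) * U = 1 := hφ (by rw [map_mul, ← hinv, hx, ← hx', Units.inv_mul, map_one])
  have hUr : U * (1 + v) = 1 := hφ (by rw [map_mul, ← hinv, hx, ← hx', Units.mul_inv, map_one])
  have heU : e * U = e * (t * a) := by
    simp only [U]
    rw [mul_add, ← mul_assoc, hide, ← mul_assoc e (1 - e), hide.mul_one_sub_self, zero_mul,
      add_zero]
  have heU' : (1 - e) * U = (1 - e) * (w * (1 - a)) := by
    simp only [U]
    rw [mul_add, ← mul_assoc, hide.one_sub_mul_self, zero_mul, ← mul_assoc, hide.one_sub,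
      zero_add]
  refine ⟨(1 + v) * e * U, (1 + v) * e * t, (1 + v) * (1 - e) * w, ?_, ?_, ?_⟩
  · unfold IsIdempotentElem
    calc (1 + v) * e * U * ((1 + v) * e * U) = (1 + v) * e * (U * (1 + v)) * e * U := by
          simp only [mul_assoc]
      _ = (1 + v) * (e * e) * U := by rw [hUr, mul_one]; simp only [mul_assoc]
      _ = _ := by rw [hide]
  · rw [mul_assoc, heU]; simp only [mul_assoc]
  · calc 1 - (1 + v) * e * U = (1 + v) * ((1 - e) * U) := by
          rw [sub_mul, one_mul, mul_sub, hUl, mul_assoc]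
      _ = _ := by rw [heU']; simp only [mul_assoc]

/-! ### Matrices over a local ring -/

theorem Matrix.isUnit_of_isUnit_map_residue {S : Type*} [CommRing S] [IsLocalRing S] {m : ℕ}
    (A : Matrix (Fin m) (Fin m) S) (h : IsUnit (A.map (IsLocalRing.residue S))) : IsUnit A := by
  rw [Matrix.isUnit_iff_isUnit_det] at h ⊢
  have : (A.map (IsLocalRing.residue S)).det = IsLocalRing.residue S A.det :=
    (RingHom.map_det _ _).symm
  rw [this] at h
  exact isUnit_of_map_unit (IsLocalRing.residue S) _ h

theorem Matrix.isUnit_one_add_smul {S : Type*} [CommRing S] [IsLocalRing S] {m : ℕ} {r : S}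
    (hr : r ∈ IsLocalRing.maximalIdeal S) (B : Matrix (Fin m) (Fin m) S) :
    IsUnit (1 + r • B) := by
  apply Matrix.isUnit_of_isUnit_map_residue
  have : (1 + r • B).map (IsLocalRing.residue S) = 1 := by
    have h0 : IsLocalRing.residue S r = 0 := Ideal.Quotient.eq_zero_iff_mem.mpr hr
    ext i j
    by_cases hij : i = j <;> simp [Matrix.one_apply, hij, h0]
  rw [this]
  exact isUnit_one

/-- Idempotent matrices over a local ring lift modulo any element. -/
theorem Matrix.exists_isIdempotentElem_lift {S : Type*} [CommRing S] [IsLocalRing S] {m : ℕ}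
    {r : S} (E Y : Matrix (Fin m) (Fin m) S)
    (hE : E * E - E = r • Y) :
    ∃ e Z : Matrix (Fin m) (Fin m) S, IsIdempotentElem e ∧ e = E + r • Z := by
  set k := IsLocalRing.ResidueField S
  set ρ := IsLocalRing.residue S
  -- Over the residue field the columns of E and of 1 - E together span; m of them form a basis. The
  -- matrix A below has the chosen columns, taken over S, and D marks those coming from E.
  let v : Fin m ⊕ Fin m → (Fin m → k) :=
    Sum.elim (fun i => (E.map ρ).col i) (fun i => ((1 - E).map ρ).col i)
  have hspan : Submodule.span k (Set.range v) = ⊤ := by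
    rw [eq_top_iff, ← (Pi.basisFun k (Fin m)).span_eq, Submodule.span_le]
    rintro _ ⟨i, rfl⟩
    have : Pi.basisFun k (Fin m) i = v (.inl i) + v (.inr i) := by
      ext j
      simp [v, Matrix.col_apply, Matrix.one_apply, Pi.single_apply, apply_ite ρ]
    rw [SetLike.mem_coe, this]
    exact add_mem (Submodule.subset_span ⟨_, rfl⟩) (Submodule.subset_span ⟨_, rfl⟩)
  obtain ⟨g, hg⟩ : ∃ g : Fin m → Fin m ⊕ Fin m, LinearIndependent k (v ∘ g) := by
    obtain ⟨f, hf, -, hli⟩ := Submodule.exists_fun_fin_finrank_span_eq k (Set.range v)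
    have hm : Module.finrank k (Submodule.span k (Set.range v)) = m := by
      rw [hspan, finrank_top, Module.finrank_fin_fun]
    choose g hg using hf
    refine ⟨fun i => g (Fin.cast hm.symm i), ?_⟩
    have : (v ∘ fun i => g (Fin.cast hm.symm i)) = f ∘ Fin.cast hm.symm := by
      ext1 i; exact hg _
    rw [this]
    exact hli.comp _ (Fin.cast_injective _)
  let C : Matrix (Fin m) (Fin m) S := Matrix.of fun i j => if g j = .inl i then 1 else 0
  let C' : Matrix (Fin m) (Fin m) S := Matrix.of fun i j => if g j = .inr i then 1 else 0
  let D : Matrix (Fin m) (Fin m) S := Matrix.diagonal fun j => if (g j).isLeft then 1 else 0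
  have hCD : C * D = C := by
    ext i j
    rcases hgj : g j with l | l <;> simp [C, D, Matrix.mul_diagonal, hgj]
  have hC'D : C' * D = 0 := by
    ext i j
    rcases hgj : g j with l | l <;> simp [C', D, Matrix.mul_diagonal, hgj]
  have hD : D * D = D := by
    simp [D, Matrix.diagonal_mul_diagonal]
  set A := E * C + (1 - E) * C'
  have hA : IsUnit A := by
    apply Matrix.isUnit_of_isUnit_map_residue
    rw [← Matrix.linearIndependent_cols_iff_isUnit]
    convert hg using 1
    ext j i
    rcases hgj : g j with l | l <;>
      simp [A, C, C', v, hgj, Matrix.mul_apply, Matrix.col_apply, ρ]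
  obtain ⟨B, hAB, hBA⟩ := isUnit_iff_exists.mp hA
  -- Modulo r, E fixes its own columns and kills those of 1 - E, so E A ≡ A D and the idempotent A D
  -- A⁻¹ lifts E.
  have hAD : A * D = E * A + r • (Y * C' - Y * C) := by
    have h1 : A * D = E * C := by
      simp only [A, add_mul, mul_assoc, hCD, hC'D, mul_zero, add_zero]
    have h2 : E * A = E * C + r • (Y * C) - r • (Y * C') := by
      have : E * E = E + r • Y := by rw [← hE]; abel
      simp only [A, mul_add, ← mul_assoc, mul_sub, mul_one, this, add_mul, sub_mul,
        smul_mul_assoc]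
      abel
    rw [h1, h2, smul_sub]; abel
  refine ⟨A * D * B, (Y * C' - Y * C) * B, ?_, ?_⟩
  · unfold IsIdempotentElem
    calc A * D * B * (A * D * B) = A * D * (B * A) * D * B := by simp only [mul_assoc]
      _ = A * (D * D) * B := by rw [hBA, mul_one]; simp only [mul_assoc]
      _ = _ := by rw [hD]
  · rw [hAD, add_mul, mul_assoc, hAB, mul_one, smul_mul_assoc]

/-! ### Coordinates and exchange endomorphism rings -/

open TensorProduct in
/-- A finitely generated torsion-free module over a domain whose fraction field carries a valuation
subring `V` containing the domain embeds into some `Qⁿ` so that it contains the standard basis and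
has coordinates in `V`. -/
theorem exists_coordinates {R : Type*} [CommRing R] [IsDomain R] {Q : Type*} [Field Q] [Algebra R Q]
    [IsFractionRing R Q] (V : Subalgebra R Q) (hV : ∀ x : Q, x ∈ V ∨ x⁻¹ ∈ V)
    (M : Type*) [AddCommGroup M] [Module R M] [Module.Finite R M] [Module.IsTorsionFree R M] :
    ∃ (n : ℕ) (c : M →ₗ[R] (Fin n → Q)), Function.Injective c ∧ (∀ m i, c m i ∈ V) ∧
      ∀ i, ∃ m, c m = Pi.single i 1 := by
  classical
  let j : M →ₗ[R] Q ⊗[R] M := TensorProduct.mk R Q M 1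
  have hjloc : IsLocalizedModule (nonZeroDivisors R) j :=
    (isLocalizedModule_iff_isBaseChange (nonZeroDivisors R) Q j).mpr
      (TensorProduct.isBaseChange R M Q)
  have hj : Function.Injective j := by
    rw [IsLocalizedModule.injective_iff_isRegular (nonZeroDivisors R)]
    intro x
    exact IsSMulRegular.of_ne_zero (nonZeroDivisors.ne_zero x.2)
  let A : ValuationSubring Q := { V.toSubring with mem_or_inv_mem' := hV }
  have hA : ∀ x, A.valuation x ≤ 1 ↔ x ∈ V := fun x => A.valuation_le_one_iff x
  obtain ⟨s, hs⟩ := Module.Finite.fg_top (R := R) (M := M)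
  -- A V-spanning subset of M of least cardinality turns out to be a Q-basis.
  let P : ℕ → Prop := fun k => ∃ t : Finset M, t.card = k ∧
    ∀ m, j m ∈ Submodule.span V (j '' t)
  have hP : ∃ k, P k := by
    refine ⟨s.card, s, rfl, fun m => ?_⟩
    have : m ∈ Submodule.span R (s : Set M) := by rw [hs]; trivial
    induction this using Submodule.span_induction with
    | mem x hx => exact Submodule.subset_span ⟨x, hx, rfl⟩
    | zero => rw [map_zero]; exact zero_mem _
    | add x y _ _ hx hy => rw [map_add]; exact add_mem hx hy
    | smul a x _ hx =>
      rw [map_smul, ← algebraMap_smul V a (j x)]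
      exact Submodule.smul_mem _ _ hx
  obtain ⟨t, htcard, ht⟩ := Nat.find_spec hP
  have hmin : ∀ t' : Finset M, (∀ m, j m ∈ Submodule.span V (j '' t')) → t.card ≤ t'.card := by
    intro t' ht'
    rw [htcard]
    exact Nat.find_min' hP ⟨t', rfl, ht'⟩
  have hli : LinearIndependent Q (fun x : t => j x) := by
    by_contra hcon
    obtain ⟨g, hg, i₁, hi₁⟩ := Fintype.not_linearIndependent_iff.mp hcon
    -- Dividing a relation by its coefficient of largest valuation puts all coefficients in V, which
    -- makes one generator redundant.
    obtain ⟨i₀, -, hi₀⟩ := Finset.exists_max_image Finset.univ (fun i => A.valuation (g i))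
      ⟨i₁, Finset.mem_univ _⟩
    have hg0 : g i₀ ≠ 0 := by
      intro h
      have := hi₀ i₁ (Finset.mem_univ _)
      rw [h, map_zero, le_zero_iff, map_eq_zero] at this
      exact hi₁ this
    have hdiv : ∀ i, (g i₀)⁻¹ * g i ∈ V := by
      intro i
      rw [← hA, map_mul, map_inv₀, mul_comm]
      exact mul_inv_le_one_of_le₀ (hi₀ i (Finset.mem_univ _)) zero_le
    have hmem : j i₀ ∈ Submodule.span V (j '' (t.erase i₀.1 : Finset M)) := by
      have h1 : (g i₀)⁻¹ • ∑ i, g i • j i.1 = 0 := by rw [hg, smul_zero]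
      rw [Finset.smul_sum, ← Finset.add_sum_erase _ _ (Finset.mem_univ i₀), smul_smul,
        inv_mul_cancel₀ hg0, one_smul] at h1
      rw [eq_neg_of_add_eq_zero_left h1]
      refine neg_mem (sum_mem fun i hi => ?_)
      rw [smul_smul]
      exact Submodule.smul_mem _ (⟨_, hdiv i⟩ : V) (Submodule.subset_span ⟨i.1,
        Finset.mem_coe.mpr (Finset.mem_erase.mpr
          ⟨fun h => (Finset.mem_erase.mp hi).1 (Subtype.ext h), i.2⟩), rfl⟩)
    have hle : Submodule.span V (j '' (t : Set M)) ≤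
        Submodule.span V (j '' (t.erase i₀.1 : Finset M)) := by
      rw [Submodule.span_le]
      rintro _ ⟨x, hx, rfl⟩
      by_cases h : x = i₀.1
      · rw [h]; exact hmem
      · exact Submodule.subset_span ⟨x, Finset.mem_coe.mpr (Finset.mem_erase.mpr ⟨h, hx⟩), rfl⟩
    have := hmin _ fun m => hle (ht m)
    exact absurd this (not_le.mpr (Finset.card_erase_lt_of_mem i₀.2))
  have hspan : ⊤ ≤ Submodule.span Q (Set.range fun x : t => j x) := by
    have h1 : ∀ m, j m ∈ Submodule.span Q (Set.range fun x : t => j x) := by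
      intro m
      have h2 : Submodule.span V (j '' (t : Set M)) ≤
          (Submodule.span Q (Set.range fun x : t => j x)).restrictScalars V := by
        rw [Submodule.span_le]
        rintro _ ⟨x, hx, rfl⟩
        exact Submodule.subset_span ⟨⟨x, hx⟩, rfl⟩
      exact h2 (ht m)
    rintro z -
    induction z with
    | zero => exact zero_mem _
    | tmul q m =>
      have : q ⊗ₜ[R] m = q • j m := by simp [j, smul_tmul']
      rw [this]
      exact Submodule.smul_mem _ _ (h1 m)
    | add x y hx hy => exact add_mem hx hy
  let b : Module.Basis (Fin t.card) Q (Q ⊗[R] M) :=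
    (Module.Basis.mk hli hspan).reindex t.equivFin
  have hb : ∀ i, b i = j (t.equivFin.symm i).1 := by
    intro i; simp [b]
  refine ⟨t.card, (b.equivFun.toLinearMap.restrictScalars R) ∘ₗ j, ?_, ?_, ?_⟩
  · exact b.equivFun.injective.comp hj
  · intro m i
    let N : Submodule V (Q ⊗[R] M) :=
      { carrier := {w | ∀ i, b.equivFun w i ∈ V}
        add_mem' := fun {x y} hx hy i => by rw [map_add]; exact add_mem (hx i) (hy i)
        zero_mem' := fun i => by rw [map_zero]; exact zero_mem _
        smul_mem' := fun a x hx i => by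
          have : a • x = (a : Q) • x := rfl
          rw [this, map_smul]
          exact mul_mem a.2 (hx i) }
    have hN : Submodule.span V (j '' (t : Set M)) ≤ N := by
      rw [Submodule.span_le]
      rintro _ ⟨x, hx, rfl⟩ i
      have : j x = b (t.equivFin ⟨x, hx⟩) := by rw [hb]; simp
      rw [this, Module.Basis.equivFun_self]
      split_ifs
      · exact one_mem _
      · exact zero_mem _
    exact hN (ht m) i
  · intro i
    refine ⟨(t.equivFin.symm i).1, ?_⟩
    ext k
    simp only [LinearMap.comp_apply, ← hb, LinearMap.restrictScalars_apply,
      LinearEquiv.coe_coe, Module.Basis.equivFun_self, Pi.single_apply, eq_comm]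

/-- Finitely many integral fractions lie in a finite subalgebra with nonzero conductor, which is
local when it is contained in an integral local overring. -/
theorem exists_finite_subalgebra {R : Type*} [CommRing R] [IsDomain R] [IsLocalRing R]
    (hR : ¬ IsField R) {Q : Type*} [Field Q] [Algebra R Q] [IsFractionRing R Q]
    (V : Subalgebra R Q) (hint : ∀ x ∈ V, IsIntegral R x) (s : Set Q)
    (hs : s.Finite) (hsV : s ⊆ V) :
    ∃ S : Subalgebra R Q, S ≤ V ∧ s ⊆ S ∧ Module.Finite R S ∧ (IsLocalRing V → IsLocalRing S) ∧
      ∃ r : R, r ≠ 0 ∧ r ∈ IsLocalRing.maximalIdeal R ∧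
        ∀ y ∈ S, ∃ x : R, algebraMap R Q x = r • y := by
  have hSV : Algebra.adjoin R s ≤ V := Algebra.adjoin_le hsV
  have hfg : (Subalgebra.toSubmodule (Algebra.adjoin R s)).FG :=
    fg_adjoin_of_finite hs fun x hx => hint x (hsV hx)
  refine ⟨Algebra.adjoin R s, hSV, Algebra.subset_adjoin, ⟨(Submodule.fg_top _).mpr hfg⟩, ?_, ?_⟩
  · intro hVl
    let f : R →+* Algebra.adjoin R s := algebraMap R _
    let g : Algebra.adjoin R s →+* V := (Subalgebra.inclusion hSV).toRingHom
    have hg : g.IsIntegral := by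
      refine RingHom.IsIntegral.tower_top f g fun x => ?_
      have : IsIntegral R x := (isIntegral_algHom_iff V.val Subtype.val_injective).mp (hint x x.2)
      exact this
    -- Integrality of V over the subalgebra keeps nonunits nonunits, so locality descends.
    have : IsLocalHom g := hg.isLocalHom (Subalgebra.inclusion_injective hSV)
    exact RingHom.domain_isLocalRing g
  · obtain ⟨t, ht⟩ := hfg
    obtain ⟨d, hd⟩ := IsLocalization.exist_integer_multiples_of_finset (nonZeroDivisors R) t
    obtain ⟨e, he, he0⟩ := Submodule.exists_mem_ne_zero_of_ne_bot
      (mt IsLocalRing.isField_iff_maximalIdeal_eq.mpr hR)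
    -- Here d clears the denominators of the module generators, and e puts the product into the
    -- maximal ideal.
    refine ⟨e * d, mul_ne_zero he0 (nonZeroDivisors.ne_zero d.2), Ideal.mul_mem_right _ _ he, ?_⟩
    intro y hy
    have hy' : y ∈ Submodule.span R (t : Set Q) := by rw [ht]; exact hy
    clear hy
    induction hy' using Submodule.span_induction with
    | mem x hx =>
      obtain ⟨a, ha⟩ := hd x hx
      exact ⟨e * a, by rw [map_mul, ha, mul_smul, Algebra.smul_def e]⟩
    | zero => exact ⟨0, by simp⟩
    | add x y _ _ hx hy =>
      obtain ⟨a, ha⟩ := hx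
      obtain ⟨b, hb⟩ := hy
      exact ⟨a + b, by rw [map_add, ha, hb, smul_add]⟩
    | smul a x _ hx =>
      obtain ⟨b, hb⟩ := hx
      exact ⟨a * b, by rw [map_mul, hb, smul_comm _ a x, Algebra.smul_def a]⟩

/-- A module with coordinates has its endomorphisms given by matrices. -/
theorem coordinates_end {R : Type*} [CommRing R] [IsDomain R] {Q : Type*} [Field Q] [Algebra R Q]
    [IsFractionRing R Q] {M : Type*} [AddCommGroup M] [Module R M] {n : ℕ}
    {c : M →ₗ[R] (Fin n → Q)} (hc : Function.Injective c) {x : Fin n → M}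
    (hx : ∀ i, c (x i) = Pi.single i 1) (f : Module.End R M) (m : M) (i : Fin n) :
    c (f m) i = ∑ j, c (f (x j)) i * c m j := by
  obtain ⟨d, hd⟩ := IsLocalization.exist_integer_multiples_of_finite (nonZeroDivisors R)
    (fun j => c m j)
  choose a ha using hd
  have h1 : (d : R) • m = ∑ j, a j • x j := by
    apply hc
    rw [map_smul, map_sum]
    ext k
    simp only [map_smul, hx, Pi.smul_apply, Finset.sum_apply, ← ha]
    simp [Pi.single_apply, Algebra.smul_def]
  have hd0 : algebraMap R Q d ≠ 0 := by
    rw [Ne, FaithfulSMul.algebraMap_eq_zero_iff]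
    exact nonZeroDivisors.ne_zero d.2
  apply mul_left_cancel₀ hd0
  rw [← Algebra.smul_def, ← Pi.smul_apply, ← map_smul, ← map_smul, h1]
  simp only [map_sum, map_smul, Finset.sum_apply, Pi.smul_apply, Finset.mul_sum]
  refine Finset.sum_congr rfl fun j _ => ?_
  rw [Algebra.smul_def, ha, Algebra.smul_def]
  ring

/-- Endomorphism rings of finitely generated torsion-free modules over a one-dimensional local
domain whose integral closure is a valuation ring are exchange rings. -/
theorem isExchangeRing_end {R : Type*} [CommRing R] [IsDomain R] [IsLocalRing R]
    [Ring.DimensionLEOne R] (hR : ¬ IsField R) {Q : Type*} [Field Q] [Algebra R Q]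
    [IsFractionRing R Q] (V : Subalgebra R Q) [IsLocalRing V] (hV : ∀ x : Q, x ∈ V ∨ x⁻¹ ∈ V)
    (hint : ∀ x ∈ V, IsIntegral R x)
    (M : Type*) [AddCommGroup M] [Module R M] [Module.Finite R M] [Module.IsTorsionFree R M] :
    IsExchangeRing (Module.End R M) := by
  obtain ⟨n, c, hc, hcV, hcs⟩ := exists_coordinates V hV M
  choose x hx using hcs
  obtain ⟨s, hs⟩ := Module.Finite.fg_top (R := R) (M := M)
  obtain ⟨S, hSV, hsS, hSfin, hSloc, r, hr0, hrm, hrS⟩ := exists_finite_subalgebra hR V hint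
    (⋃ m ∈ s, Set.range (c m)) (s.finite_toSet.biUnion fun m _ => Set.finite_range _) (by
      rintro _ hq
      simp only [Set.mem_iUnion] at hq
      obtain ⟨m, -, i, rfl⟩ := hq
      exact hcV m i)
  have hSl : IsLocalRing S := hSloc inferInstance
  have hcS : ∀ m i, c m i ∈ S := by
    intro m i
    have : m ∈ Submodule.span R (s : Set M) := by rw [hs]; trivial
    induction this using Submodule.span_induction with
    | mem m hm => exact hsS (Set.mem_biUnion hm ⟨i, rfl⟩)
    | zero => rw [map_zero]; exact zero_mem _
    | add x y _ _ hx hy => rw [map_add]; exact add_mem hx hy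
    | smul a x _ hx => rw [map_smul]; exact S.smul_mem hx a
  have key := coordinates_end hc hx
  let W := Matrix (Fin n) (Fin n) S
  let φ₀ : Module.End R M →ₗ[R] W :=
    { toFun := fun f => Matrix.of fun i j => ⟨c (f (x j)) i, hcS _ _⟩
      map_add' := fun f g => by ext i j; simp; rfl
      map_smul' := fun a f => by ext i j; simp; rfl }
  have hφ₀ : ∀ f i j, (φ₀ f i j : Q) = c (f (x j)) i := fun f i j => rfl
  let φ : Module.End R M →ₐ[R] W := AlgHom.ofLinearMap φ₀
    (by
      ext i j
      rw [hφ₀, Module.End.one_apply, hx, Matrix.one_apply, Pi.single_apply]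
      split_ifs <;> simp)
    (fun f g => by
      ext i j
      rw [hφ₀, Module.End.mul_apply, key, Matrix.mul_apply]
      simp [hφ₀])
  have hφ : ∀ f i j, (φ f i j : Q) = c (f (x j)) i := fun f i j => rfl
  have hinj : Function.Injective φ := by
    intro f g hfg
    ext m
    apply hc
    ext i
    rw [key f, key g]
    refine Finset.sum_congr rfl fun j _ => ?_
    rw [← hφ, ← hφ, hfg]
  refine IsExchangeRing.of_lifting φ hinj r ?_ ?_ ?_ ?_
  · intro B
    -- The matrix r B maps M into Rⁿ, since r S ⊆ R, and Rⁿ lies inside M because M contains the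
    -- standard basis.
    let L : M →ₗ[R] (Fin n → Q) :=
      { toFun := fun m i => r • ∑ j, (B i j : Q) * c m j
        map_add' := fun m m' => by
          ext i; simp [mul_add, Finset.sum_add_distrib]
        map_smul' := fun a m => by
          ext i
          simp only [map_smul, Pi.smul_apply, mul_smul_comm, ← Finset.smul_sum, RingHom.id_apply]
          rw [smul_comm] }
    have hL : ∀ m, L m ∈ LinearMap.range c := by
      intro m
      have : ∀ i, ∃ a : R, algebraMap R Q a = L m i := fun i =>
        hrS _ (sum_mem fun j _ => mul_mem (B i j).2 (hcS m j))
      choose a ha using this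
      refine ⟨∑ i, a i • x i, ?_⟩
      ext k
      rw [← ha k]
      simp [hx, Pi.single_apply, Algebra.smul_def]
    refine ⟨(LinearEquiv.ofInjective c hc).symm.toLinearMap ∘ₗ L.codRestrict _ hL, ?_⟩
    ext i j
    rw [hφ]
    have : c (((LinearEquiv.ofInjective c hc).symm.toLinearMap ∘ₗ L.codRestrict _ hL) (x j)) =
        L (x j) := by
      have := (LinearEquiv.ofInjective c hc).apply_symm_apply (L.codRestrict _ hL (x j))
      exact congrArg Subtype.val this
    rw [this]
    simp [L, hx, Pi.single_apply]
    rfl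
  · intro B
    have h1 : IsLocalHom (algebraMap R S) := inferInstance
    have h2 : algebraMap R S r ∈ IsLocalRing.maximalIdeal S := by
      rw [IsLocalRing.mem_maximalIdeal] at hrm ⊢
      exact fun h => hrm (isUnit_of_map_unit _ _ h)
    have := Matrix.isUnit_one_add_smul h2 B
    rwa [algebraMap_smul] at this
  · intro E Y hEY
    rw [← algebraMap_smul S r Y] at hEY
    obtain ⟨e, Z, he, heZ⟩ := Matrix.exists_isIdempotentElem_lift E Y hEY
    exact ⟨e, Z, he, by rw [heZ, algebraMap_smul]⟩
  · intro f
    obtain ⟨t, w, y, z, h1, h2⟩ :=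
      (Algebra.IsIntegral.isIntegral (R := R) f).exists_idempotent_mod hr0
    exact ⟨_, _, y, z, h1, h2⟩

/-! ### Independent families of submodules and their refinements -/

theorem iSupIndep.sigma {α : Type*} [CompleteLattice α] [IsModularLattice α]
    [IsCompactlyGenerated α] {ι : Type*} {κ : ι → Type*} {f : (Σ i, κ i) → α}
    (h : iSupIndep fun i => ⨆ j, f ⟨i, j⟩) (h' : ∀ i, iSupIndep fun j => f ⟨i, j⟩) :
    iSupIndep f := by
  classical
  rw [iSupIndep_iff_supIndep]
  intro s
  have hs : s ⊆ (s.image Sigma.fst).sigma fun i => s.preimage (Sigma.mk i)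
      sigma_mk_injective.injOn := by
    rintro ⟨i, j⟩ hij
    rw [Finset.mem_sigma, Finset.mem_preimage]
    exact ⟨Finset.mem_image_of_mem _ hij, hij⟩
  refine Finset.SupIndep.subset (Finset.SupIndep.sigma ?_ ?_) hs
  · exact (h.supIndep' _).mono fun i _ => Finset.sup_le fun j _ => le_iSup (fun j => f ⟨i, j⟩) j
  · exact fun i _ => (h' i).supIndep' _

theorem Finset.sSupIndep_iff_supIndep {α : Type*} [CompleteLattice α] {s : Finset α} :
    sSupIndep (s : Set α) ↔ s.SupIndep id := by
  rw [sSupIndep_iff, ← iSupIndep_comp_coe_iff_supIndep]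
  rfl

theorem sSupIndep.union {α : Type*} [CompleteLattice α] [IsModularLattice α]
    [IsCompactlyGenerated α] {s t : Set α} (hs : sSupIndep s) (ht : sSupIndep t)
    (h : Disjoint (sSup s) (sSup t)) : sSupIndep (s ∪ t) := by
  classical
  rw [sSupIndep_iff_finite]
  intro u hu
  rw [Finset.sSupIndep_iff_supIndep]
  have : u = u.filter (· ∈ s) ∪ u.filter (· ∈ t) := by
    ext x
    simp only [Finset.mem_union, Finset.mem_filter]
    constructor
    · intro hx
      rcases hu hx with h | h
      · exact .inl ⟨hx, h⟩
      · exact .inr ⟨hx, h⟩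
    · rintro (h | h) <;> exact h.1
  rw [this]
  refine Finset.SupIndep.union ?_ ?_ ?_
  · rw [← Finset.sSupIndep_iff_supIndep]
    exact hs.mono fun x hx => (Finset.mem_filter.mp hx).2
  · rw [← Finset.sSupIndep_iff_supIndep]
    exact ht.mono fun x hx => (Finset.mem_filter.mp hx).2
  · exact h.mono (Finset.sup_le fun x hx => le_sSup (Finset.mem_filter.mp hx).2)
      (Finset.sup_le fun x hx => le_sSup (Finset.mem_filter.mp hx).2)

/-- The submodule `A` is the internal direct sum of submodules having the property `P`. -/
def Submodule.DecomposesInto {R : Type u} [CommRing R] {X : Type v} [AddCommGroup X] [Module R X]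
    (A : Submodule R X) (P : Submodule R X → Prop) : Prop :=
  ∃ (ι : Type v) (N : ι → Submodule R X), iSupIndep N ∧ ⨆ i, N i = A ∧ ∀ i, P (N i)

section

variable {R : Type u} [CommRing R] {X : Type v} [AddCommGroup X] [Module R X]

theorem isDirectSumOf_iff_decomposesInto {P : Submodule R X → Prop} :
    IsDirectSumOf R X P ↔ (⊤ : Submodule R X).DecomposesInto P := by
  classical
  constructor
  · rintro ⟨ι, _, N, hN, hP⟩
    exact ⟨ι, N, hN.submodule_iSupIndep, hN.submodule_iSup_eq_top, hP⟩
  · rintro ⟨ι, N, hN, hN', hP⟩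
    exact ⟨ι, Classical.decEq ι, N,
      (DirectSum.isInternal_submodule_iff_iSupIndep_and_iSup_eq_top N).mpr ⟨hN, hN'⟩, hP⟩

theorem Submodule.DecomposesInto.isDirectSumOf {A : Submodule R X} {P : Submodule R X → Prop}
    {P' : Submodule R A → Prop} (h : A.DecomposesInto P)
    (hP : ∀ N ≤ A, P N → P' (N.comap A.subtype)) : IsDirectSumOf R A P' := by
  rw [isDirectSumOf_iff_decomposesInto]
  obtain ⟨ι, N, hN, hNA, hPN⟩ := h
  have hle : ∀ i, N i ≤ A := fun i => hNA ▸ le_iSup N i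
  have hmap : ∀ i, ((N i).comap A.subtype).map A.subtype = N i := fun i => by
    rw [Submodule.map_comap_subtype, inf_eq_right.mpr (hle i)]
  refine ⟨ι, fun i => (N i).comap A.subtype, ?_, ?_, fun i => hP _ (hle i) (hPN i)⟩
  · rw [← iSupIndep_map_orderIso_iff (Submodule.mapIic A)]
    apply iSupIndep.of_coe_Iic_comp
    convert hN using 1
    ext1 i
    exact hmap i
  · apply Submodule.map_injective_of_injective A.injective_subtype
    rw [Submodule.map_iSup, Submodule.map_subtype_top]
    simp only [hmap, hNA]

theorem Submodule.DecomposesInto.mono {A : Submodule R X} {P P' : Submodule R X → Prop}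
    (h : A.DecomposesInto P) (hP : ∀ N ≤ A, P N → P' N) : A.DecomposesInto P' := by
  obtain ⟨ι, N, hN, hNA, hPN⟩ := h
  exact ⟨ι, N, hN, hNA, fun i => hP _ (hNA ▸ le_iSup N i) (hPN i)⟩

theorem Submodule.DecomposesInto.iSup {ι : Type v} {B : ι → Submodule R X}
    {P : Submodule R X → Prop} (hB : iSupIndep B) (h : ∀ i, (B i).DecomposesInto P) :
    (⨆ i, B i).DecomposesInto P := by
  choose κ N hN hNB hP using h
  refine ⟨Σ i, κ i, fun p => N p.1 p.2, iSupIndep.sigma ?_ hN, ?_, fun p => hP _ _⟩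
  · simpa only [hNB] using hB
  · rw [iSup_sigma]
    simp only [hNB]

theorem Submodule.DecomposesInto.sup {B C : Submodule R X} {P : Submodule R X → Prop}
    (hBC : Disjoint B C) (hB : B.DecomposesInto P) (hC : C.DecomposesInto P) :
    (B ⊔ C).DecomposesInto P := by
  let D : ULift.{v} Bool → Submodule R X := fun i => bif i.down then B else C
  have hD : ⨆ i, D i = B ⊔ C := by
    have : ⨆ i, D i = ⨆ i : Bool, bif i then B else C := Equiv.ulift.iSup_congr fun i => rfl
    rw [this, iSup_bool_eq]
    rfl
  rw [← hD]
  refine Submodule.DecomposesInto.iSup ?_ ?_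
  · rw [iSupIndep_pair (i := ⟨true⟩) (j := ⟨false⟩) (by simp) (by rintro ⟨_ | _⟩ <;> simp)]
    exact hBC
  · rintro ⟨_ | _⟩
    · exact hC
    · exact hB

end

/-! ### Exchange, countably generated summands and Kaplansky's dévissage -/

/-- If finitely generated submodules of a torsion-free module have exchange endomorphism rings, they
are direct sums of submodules with local endomorphism rings. -/
theorem Submodule.decomposesInto_localEnd {R : Type u} [CommRing R] [IsDomain R] {X : Type v}
    [AddCommGroup X] [Module R X] [Module.IsTorsionFree R X]
    (hex : ∀ B : Submodule R X, Module.Finite R B → IsExchangeRing (Module.End R B))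
    (A : Submodule R X) (hA : Module.Finite R A) :
    A.DecomposesInto fun N => Module.Finite R N ∧ IsLocalRing (Module.End R N) := by
  induction hn : Module.finrank R A using Nat.strong_induction_on generalizing A with
  | _ n ih =>
  by_cases hbot : A = ⊥
  · subst hbot
    exact ⟨PEmpty, fun i => i.elim, fun i => i.elim, by simp, fun i => i.elim⟩
  have hnt : Nontrivial A := Submodule.nontrivial_iff_ne_bot.mpr hbot
  by_cases hid : ∀ e : Module.End R A, IsIdempotentElem e → e = 0 ∨ e = 1
  · exact ⟨PUnit, fun _ => A, iSupIndep_subsingleton _, by simp,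
      fun _ => ⟨hA, (hex A hA).isLocalRing hid⟩⟩
  push Not at hid
  obtain ⟨e, he, he0, he1⟩ := hid
  have step : ∀ f : Module.End R A, IsIdempotentElem f → f ≠ 1 →
      ((LinearMap.range f).map A.subtype).DecomposesInto
        fun N => Module.Finite R N ∧ IsLocalRing (Module.End R N) := by
    intro f hf hf1
    have hfin : Module.Finite R (LinearMap.range f) := inferInstance
    have hfin' : Module.Finite R (LinearMap.ker f) := by
      rw [LinearMap.IsIdempotentElem.ker_eq_range_one_sub hf]; infer_instance
    have heq := (Submodule.equivSubtypeMap A (LinearMap.range f))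
    have hker : 0 < Module.finrank R (LinearMap.ker f) := by
      have : Nontrivial (LinearMap.ker f) := by
        rw [Submodule.nontrivial_iff_ne_bot, LinearMap.IsIdempotentElem.ker_eq_range_one_sub hf,
          Ne, LinearMap.range_eq_bot, sub_eq_zero]
        exact hf1.symm
      exact Module.finrank_pos
    have hsum := Submodule.finrank_quotient_add_finrank (LinearMap.ker f)
    rw [f.quotKerEquivRange.finrank_eq] at hsum
    refine ih _ ?_ _ (Module.Finite.equiv heq) rfl
    rw [← hn, ← heq.finrank_eq]
    omega
  have hcompl := LinearMap.IsIdempotentElem.isCompl he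
  rw [LinearMap.IsIdempotentElem.ker_eq_range_one_sub he] at hcompl
  have hA' : A = (LinearMap.range e).map A.subtype ⊔ (LinearMap.range (1 - e)).map A.subtype := by
    rw [← Submodule.map_sup, hcompl.sup_eq_top, Submodule.map_subtype_top]
  rw [hA']
  refine Submodule.DecomposesInto.sup ?_ (step e he he1) (step _ he.one_sub fun h => he0 ?_)
  · exact Submodule.disjoint_map A.injective_subtype hcompl.disjoint
  · simpa using h

section Summands

variable {R : Type u} [CommRing R] {X : Type v} [AddCommGroup X] [Module R X]

theorem iSupIndep_range_of_orthogonal {ι : Type*} {g : ι → Module.End R X}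
    (hg : ∀ i, IsIdempotentElem (g i)) (horth : ∀ i j, i ≠ j → g i * g j = 0) :
    iSupIndep fun i => LinearMap.range (g i) := by
  rw [iSupIndep_def]
  intro i
  rw [Submodule.disjoint_def]
  intro x hx hx'
  have hle : ⨆ j, ⨆ (_ : j ≠ i), LinearMap.range (g j) ≤ LinearMap.ker (g i) := by
    refine iSup₂_le fun j hj => ?_
    rintro _ ⟨y, rfl⟩
    rw [LinearMap.mem_ker, ← Module.End.mul_apply, horth i j hj.symm, LinearMap.zero_apply]
  rw [← (LinearMap.IsIdempotentElem.mem_range_iff (hg i)).mp hx]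
  exact hle hx'

/-- If every element of `X` lies in a finitely generated summand and these have exchange
endomorphism rings, then every element of a summand of `X` lies in a finitely generated summand of
that summand. -/
theorem exists_idempotent_fg_of_mem
    (hloc : ∀ x : X, ∃ B C : Submodule R X, IsCompl B C ∧ Module.Finite R B ∧ x ∈ B)
    (hex : ∀ B : Submodule R X, Module.Finite R B → IsExchangeRing (Module.End R B))
    {e : Module.End R X} (he : IsIdempotentElem e) {x : X} (hx : e x = x) :
    ∃ g : Module.End R X, IsIdempotentElem g ∧ e * g = g ∧ g * e = g ∧
      Module.Finite R (LinearMap.range g) ∧ g x = x := by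
  obtain ⟨B, C, hBC, hB, hxB⟩ := hloc x
  let p : X →ₗ[R] B := B.projectionOnto C hBC
  let t : Module.End R B := p ∘ₗ e ∘ₗ B.subtype
  obtain ⟨f, s, w, hf, hs, hw⟩ := hex B hB t
  let xB : B := ⟨x, hxB⟩
  have htx : t xB = xB := by
    change p (e x) = xB
    rw [hx]
    exact Submodule.projectionOnto_apply_left hBC xB
  have hfx : f xB = xB := by
    have : (1 - f) xB = 0 := by
      rw [hw, Module.End.mul_apply, LinearMap.sub_apply, htx, Module.End.one_apply, sub_self,
        map_zero]
    rw [LinearMap.sub_apply, sub_eq_zero] at this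
    exact this.symm
  -- Since f = s t and t = p e on B, the maps satisfy β α = f and α f = α. Hence α β is an
  -- idempotent of X with the same range as α, which is a quotient of B.
  let α : B →ₗ[R] X := e ∘ₗ B.subtype ∘ₗ f
  let β : X →ₗ[R] B := f ∘ₗ s ∘ₗ p ∘ₗ e
  have hee : ∀ y, e (e y) = e y := fun y => LinearMap.congr_fun he y
  have hff : ∀ y, f (f y) = f y := fun y => LinearMap.congr_fun hf y
  have hst : ∀ y : B, s (p (e y)) = f y := fun y => (LinearMap.congr_fun hs y).symm
  have hβα : ∀ y, β (α y) = f y := by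
    intro y
    simp only [α, β, LinearMap.comp_apply, Submodule.subtype_apply, hee, hst, hff]
  have hαf : ∀ y, α (f y) = α y := by
    intro y
    simp only [α, LinearMap.comp_apply, hff]
  refine ⟨α ∘ₗ β, ?_, ?_, ?_, ?_, ?_⟩
  · ext y
    change α (β (α (β y))) = α (β y)
    rw [hβα, hαf]
  · ext y
    change e (α (β y)) = α (β y)
    simp only [α, LinearMap.comp_apply, hee]
  · ext y
    change α (β (e y)) = α (β y)
    simp only [β, LinearMap.comp_apply, hee]
  · have h2 : LinearMap.range (α ∘ₗ β) = LinearMap.range α := by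
      apply le_antisymm (LinearMap.range_comp_le_range _ _)
      rintro _ ⟨y, rfl⟩
      refine ⟨α y, ?_⟩
      change α (β (α y)) = α y
      rw [hβα, hαf]
    rw [h2]
    infer_instance
  · change α (β x) = x
    have : β x = xB := by
      simp only [β, LinearMap.comp_apply]
      rw [hst xB, hff, hfx]
    rw [this]
    simp only [α, LinearMap.comp_apply, hfx]
    exact hx

/-- A countably generated summand decomposes into finitely generated submodules. -/
theorem exists_iSupIndep_fg_of_countable
    (hloc : ∀ x : X, ∃ B C : Submodule R X, IsCompl B C ∧ Module.Finite R B ∧ x ∈ B)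
    (hex : ∀ B : Submodule R X, Module.Finite R B → IsExchangeRing (Module.End R B))
    {e : Module.End R X} (he : IsIdempotentElem e) {x : ℕ → X}
    (hx : Submodule.span R (Set.range x) = LinearMap.range e) :
    ∃ N : ℕ → Submodule R X, iSupIndep N ∧ ⨆ i, N i = LinearMap.range e ∧
      ∀ i, Module.Finite R (N i) := by
  let good : Module.End R X → Prop := fun S => IsIdempotentElem S ∧ e * S = S ∧ S * e = S
  have hsub : ∀ S, good S → IsIdempotentElem (e - S) := by
    rintro S ⟨h1, h2, h3⟩
    unfold IsIdempotentElem
    rw [sub_mul, mul_sub, mul_sub, he, h1, h2, h3]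
    abel
  -- The condition `good S` sits inside the existential so that `choose` yields a total function
  -- usable in the recursion below.
  have step : ∀ S : Module.End R X, ∀ n : ℕ, ∃ g : Module.End R X, good S →
      IsIdempotentElem g ∧ e * g = g ∧ g * e = g ∧ S * g = 0 ∧ g * S = 0 ∧
        Module.Finite R (LinearMap.range g) ∧ g (x n) = (e - S) (x n) := by
    intro S n
    by_cases hS : good S
    · obtain ⟨h1, h2, h3⟩ := hS
      have hi := hsub S ⟨h1, h2, h3⟩
      obtain ⟨g, hg, heg, hge, hfin, hgx⟩ := exists_idempotent_fg_of_mem hloc hex hi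
        (x := (e - S) (x n)) (LinearMap.congr_fun hi (x n))
      have he1 : e * (e - S) = e - S := by rw [mul_sub, he, h2]
      have he2 : (e - S) * e = e - S := by rw [sub_mul, he, h3]
      have hS1 : S * (e - S) = 0 := by rw [mul_sub, h3, h1, sub_self]
      have hS2 : (e - S) * S = 0 := by rw [sub_mul, h2, h1, sub_self]
      refine ⟨g, fun _ => ⟨hg, ?_, ?_, ?_, ?_, hfin, ?_⟩⟩
      · rw [← heg, ← mul_assoc, he1]
      · rw [← hge, mul_assoc, he2]
      · rw [← heg, ← mul_assoc, hS1, zero_mul]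
      · rw [← hge, mul_assoc, hS2, mul_zero]
      · rw [← hgx, ← Module.End.mul_apply, hge]
    · exact ⟨0, fun h => absurd h hS⟩
  choose G hG using step
  -- S n is the sum of the first n orthogonal idempotents. The n-th one is taken below e - S n and
  -- fixes (e - S n)(x n), so S (n + 1) fixes x n.
  let S : ℕ → Module.End R X := fun n => Nat.rec 0 (fun n S => S + G S n) n
  have hS0 : S 0 = 0 := rfl
  have hSs : ∀ n, S (n + 1) = S n + G (S n) n := fun n => rfl
  have hgood : ∀ n, good (S n) := by
    intro n
    induction n with
    | zero => rw [hS0]; exact ⟨IsIdempotentElem.zero, mul_zero _, zero_mul _⟩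
    | succ n ih =>
      obtain ⟨g1, g2, g3, g4, g5, -, -⟩ := hG _ n ih
      obtain ⟨i1, i2, i3⟩ := ih
      rw [hSs]
      refine ⟨?_, ?_, ?_⟩
      · unfold IsIdempotentElem
        rw [add_mul, mul_add, mul_add, i1, g4, g5, g1, add_zero, zero_add]
      · rw [mul_add, i2, g2]
      · rw [add_mul, i3, g3]
  set g : ℕ → Module.End R X := fun n => G (S n) n
  have hgS : ∀ k n, k < n → S n * g k = g k ∧ g k * S n = g k := by
    intro k n hkn
    have hkk := hG _ k (hgood k)
    induction n, hkn using Nat.le_induction with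
    | base =>
      rw [hSs, add_mul, mul_add]
      exact ⟨by rw [hkk.2.2.2.1, zero_add]; exact hkk.1,
        by rw [hkk.2.2.2.2.1, zero_add]; exact hkk.1⟩
    | succ n hn ih =>
      have hnn := hG _ n (hgood n)
      rw [hSs, add_mul, mul_add, ih.1, ih.2]
      constructor
      · rw [← ih.1, ← mul_assoc, hnn.2.2.2.2.1, zero_mul, add_zero]
      · rw [← ih.2, mul_assoc, hnn.2.2.2.1, mul_zero, add_zero]
  have horth : ∀ i j, i ≠ j → g i * g j = 0 := by
    intro i j hij
    rcases lt_or_gt_of_ne hij with h | h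
    · rw [← (hgS i j h).2, mul_assoc, (hG _ j (hgood j)).2.2.2.1, mul_zero]
    · rw [← (hgS j i h).1, ← mul_assoc, (hG _ i (hgood i)).2.2.2.2.1, zero_mul]
  refine ⟨fun n => LinearMap.range (g n),
    iSupIndep_range_of_orthogonal (fun n => (hG _ n (hgood n)).1) horth, ?_,
    fun n => (hG _ n (hgood n)).2.2.2.2.2.1⟩
  apply le_antisymm
  · refine iSup_le fun n => ?_
    have := (hG _ n (hgood n)).2.1
    change LinearMap.range (G (S n) n) ≤ _
    rw [← this]
    exact LinearMap.range_comp_le_range _ _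
  · have hSle : ∀ n, LinearMap.range (S n) ≤ ⨆ k, LinearMap.range (g k) := by
      intro n
      induction n with
      | zero => rw [hS0, LinearMap.range_zero]; exact bot_le
      | succ n ih =>
        rintro _ ⟨y, rfl⟩
        rw [hSs, LinearMap.add_apply]
        exact add_mem (ih ⟨y, rfl⟩) (le_iSup (fun k => LinearMap.range (g k)) n ⟨y, rfl⟩)
    rw [← hx, Submodule.span_le]
    rintro _ ⟨n, rfl⟩
    have hxe : e (x n) = x n := by
      rw [← LinearMap.IsIdempotentElem.mem_range_iff he, ← hx]
      exact Submodule.subset_span ⟨n, rfl⟩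
    refine hSle (n + 1) ⟨x n, ?_⟩
    rw [hSs, LinearMap.add_apply, (hG _ n (hgood n)).2.2.2.2.2.2, LinearMap.sub_apply, hxe]
    abel

end Summands

/-- Iterating F from i stays countable, each F j being finite. This provides the countable
enlargement in the dévissage. -/
theorem Set.exists_countable_closed {ι : Type*} (F : ι → Finset ι) (i : ι) :
    ∃ C : Set ι, i ∈ C ∧ C.Countable ∧ ∀ j ∈ C, ↑(F j) ⊆ C := by
  let D : ℕ → Set ι := fun n => Nat.rec {i} (fun _ D => ⋃ j ∈ D, ↑(F j)) n
  have hD : ∀ n, D (n + 1) = ⋃ j ∈ D n, ↑(F j) := fun n => rfl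
  refine ⟨⋃ n, D n, Set.mem_iUnion.mpr ⟨0, rfl⟩, Set.countable_iUnion fun n => ?_, ?_⟩
  · induction n with
    | zero => exact Set.countable_singleton i
    | succ n ih => rw [hD]; exact ih.biUnion fun j _ => (F j).countable_toSet
  · intro j hj
    obtain ⟨n, hn⟩ := Set.mem_iUnion.mp hj
    refine Set.Subset.trans ?_ (Set.subset_iUnion D (n + 1))
    rw [hD]
    exact Set.subset_biUnion_of_mem (u := fun j => (F j : Set ι)) hn

section Summands

variable {R : Type u} [CommRing R] {X : Type v} [AddCommGroup X] [Module R X]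

theorem iSupIndep.isCompl_biSup_compl {ι : Type*} {N : ι → Submodule R X} (hN : iSupIndep N)
    (htop : ⨆ i, N i = ⊤) (J : Set ι) : IsCompl (⨆ i ∈ J, N i) (⨆ i ∈ Jᶜ, N i) := by
  refine ⟨hN.disjoint_biSup_biSup disjoint_compl_right, codisjoint_iff.mpr ?_⟩
  rw [eq_top_iff, ← htop]
  refine iSup_le fun i => ?_
  by_cases hi : i ∈ J
  · exact (le_biSup N hi).trans le_sup_left
  · exact (le_biSup N (i := i) (s := Jᶜ) hi).trans le_sup_right

theorem Submodule.exists_seq_span_eq_biSup {ι : Type*} {N : ι → Submodule R X} {C : Set ι}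
    (hC : C.Countable) (hN : ∀ i, Module.Finite R (N i)) :
    ∃ x : ℕ → X, Submodule.span R (Set.range x) = ⨆ i ∈ C, N i := by
  have : ∀ i, ∃ T : Finset X, Submodule.span R (T : Set X) = N i := fun i =>
    Module.Finite.iff_fg.mp (hN i)
  choose T hT using this
  obtain ⟨x, hx⟩ := ((hC.biUnion fun i _ => (T i).countable_toSet).insert 0).exists_eq_range
    (Set.insert_nonempty _ _)
  refine ⟨x, ?_⟩
  rw [← hx, Submodule.span_insert_zero, Submodule.span_iUnion₂]
  simp only [hT]

/-- **Kaplansky's dévissage combined with the exchange property**: if finitely generated submodules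
of `X` have exchange endomorphism rings and `X` is a direct sum of finitely generated submodules,
then so is each of its direct summands. -/
theorem Submodule.decomposesInto_fg_of_isComplemented {ι : Type*} {N : ι → Submodule R X}
    (hN : iSupIndep N) (htop : ⨆ i, N i = ⊤) (hfin : ∀ i, Module.Finite R (N i))
    (hex : ∀ B : Submodule R X, Module.Finite R B → IsExchangeRing (Module.End R B))
    (K : Submodule R X) (hK : IsComplemented K) :
    K.DecomposesInto fun B => Module.Finite R B := by
  classical
  obtain ⟨K', hKK'⟩ := hK
  set e : Module.End R X := K.projection K' hKK'
  have he : IsIdempotentElem e := Submodule.isIdempotentElem_projection hKK'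
  have hee : ∀ y, e (e y) = e y := fun y => LinearMap.congr_fun he y
  have herange : LinearMap.range e = K := Submodule.range_projection hKK'
  have hcompl := hN.isCompl_biSup_compl htop
  have hloc : ∀ x : X, ∃ B C : Submodule R X, IsCompl B C ∧ Module.Finite R B ∧ x ∈ B := by
    intro x
    have hx : x ∈ ⨆ i, N i := by rw [htop]; trivial
    obtain ⟨F, hF⟩ := Submodule.mem_iSup_iff_exists_finset.mp hx
    refine ⟨⨆ i ∈ (F : Set ι), N i, _, hcompl F, ?_, hF⟩
    exact Module.Finite.iff_fg.mpr
      (Submodule.fg_biSup F N fun i _ => Module.Finite.iff_fg.mp (hfin i))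
  have hF : ∀ i, ∃ F : Finset ι, (N i).map e ≤ ⨆ j ∈ F, N j := by
    intro i
    have : IsCompactElement ((N i).map e) :=
      (Submodule.fg_iff_compact _).mp ((Module.Finite.iff_fg.mp (hfin i)).map e)
    exact CompleteLattice.IsCompactElement.exists_finset_of_le_iSup _ this N
      (by rw [htop]; exact le_top)
  choose F hF using hF
  -- For stable J the partial sum over J is mapped into itself by e, so its image under e is again a
  -- summand of X.
  let stable : Set ι → Prop := fun J => ∀ i ∈ J, ↑(F i) ⊆ J
  have hstable : ∀ J, stable J → ∀ y ∈ ⨆ i ∈ J, N i, e y ∈ ⨆ i ∈ J, N i := by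
    intro J hJ y hy
    have hle : (⨆ i ∈ J, N i).map e ≤ ⨆ i ∈ J, N i := by
      simp only [Submodule.map_iSup]
      exact iSup₂_le fun i hi => (hF i).trans (biSup_mono fun j hj => hJ i hi hj)
    exact hle (Submodule.mem_map_of_mem hy)
  -- The second component decomposes the image under e of the partial sum. The families are nested
  -- along a chain, so decompositions pass to unions.
  let Z : Set (Set ι × Set (Submodule R X)) := {p | stable p.1 ∧ sSupIndep p.2 ∧
    sSup p.2 = (⨆ i ∈ p.1, N i).map e ∧ ∀ B ∈ p.2, Module.Finite R B}
  obtain ⟨⟨J, 𝒮⟩, ⟨hJ, hind, hsup, hfg⟩, hmax⟩ := zorn_le₀ Z (by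
    intro c hcZ hc
    refine ⟨(⋃ p ∈ c, p.1, ⋃ p ∈ c, p.2), ⟨?_, ?_, ?_, ?_⟩, fun p hp =>
      ⟨Set.subset_biUnion_of_mem (u := fun p : Set ι × Set (Submodule R X) => p.1) hp,
        Set.subset_biUnion_of_mem (u := fun p : Set ι × Set (Submodule R X) => p.2) hp⟩⟩
    · intro i hi
      obtain ⟨p, hp, hip⟩ := Set.mem_iUnion₂.mp hi
      exact ((hcZ hp).1 i hip).trans
        (Set.subset_biUnion_of_mem (u := fun p : Set ι × Set (Submodule R X) => p.1) hp)
    · change sSupIndep (⋃ p ∈ c, p.2)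
      rw [Set.biUnion_eq_iUnion]
      refine sSupIndep_iUnion_of_directed ?_ fun p => (hcZ p.2).2.1
      intro p q
      rcases hc.total p.2 q.2 with h | h
      · exact ⟨q, h.2, subset_rfl⟩
      · exact ⟨p, subset_rfl, h.2⟩
    · change sSup (⋃ p ∈ c, p.2) = (⨆ i ∈ ⋃ p ∈ c, p.1, N i).map e
      apply le_antisymm
      · refine sSup_le fun B hB => ?_
        obtain ⟨p, hp, hBp⟩ := Set.mem_iUnion₂.mp hB
        refine (le_sSup hBp).trans ?_
        rw [(hcZ hp).2.2.1]
        exact Submodule.map_mono (biSup_mono fun i hi => Set.mem_biUnion hp hi)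
      · simp only [Submodule.map_iSup]
        refine iSup₂_le fun i hi => ?_
        obtain ⟨p, hp, hip⟩ := Set.mem_iUnion₂.mp hi
        refine le_trans (b := sSup p.2) ?_ (sSup_le_sSup fun B hB => Set.mem_biUnion hp hB)
        rw [(hcZ hp).2.2.1]
        exact Submodule.map_mono (le_iSup₂_of_le i hip le_rfl)
    · intro B hB
      obtain ⟨p, hp, hBp⟩ := Set.mem_iUnion₂.mp hB
      exact (hcZ hp).2.2.2 B hBp)
  have hJuniv : J = Set.univ := by
    by_contra hne
    obtain ⟨i, hi⟩ := (Set.ne_univ_iff_exists_notMem J).mp hne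
    obtain ⟨C, hiC, hCc, hC⟩ := Set.exists_countable_closed F i
    set J' := J ∪ C
    have hJ' : stable J' := by
      rintro j (hj | hj)
      · exact (hJ j hj).trans Set.subset_union_left
      · exact (hC j hj).trans Set.subset_union_right
    set A := ⨆ i ∈ J, N i
    set A' := ⨆ i ∈ J', N i
    have hAA' : A' = A ⊔ ⨆ i ∈ C, N i := iSup_union
    set P := A.projection _ (hcompl J)
    set P' := A'.projection _ (hcompl J')
    have hPA : ∀ y ∈ A, P y = y := fun y hy => Submodule.projection_apply_of_mem_left _ hy
    have hPA' : ∀ y ∈ A', P' y = y := fun y hy => Submodule.projection_apply_of_mem_left _ hy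
    have hPm : ∀ y, P y ∈ A := fun y => Submodule.projection_apply_mem _ y
    have hPm' : ∀ y, P' y ∈ A' := fun y => Submodule.projection_apply_mem _ y
    have hAle : A ≤ A' := hAA' ▸ le_sup_left
    set q : Module.End R X := e * P
    set q' : Module.End R X := e * P'
    have hq : ∀ y, q y = e (P y) := fun y => rfl
    have hq' : ∀ y, q' y = e (P' y) := fun y => rfl
    have hqA : ∀ y ∈ A, q (e y) = e y := by
      intro y hy
      rw [hq, hPA _ (hstable J hJ y hy), hee]
    have hqA' : ∀ y ∈ A', q' (e y) = e y := by
      intro y hy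
      rw [hq', hPA' _ (hstable J' hJ' y hy), hee]
    have h1 : q * q = q := by
      ext y; exact hqA _ (hPm y)
    have h2 : q' * q' = q' := by
      ext y; exact hqA' _ (hPm' y)
    have h3 : q' * q = q := by
      ext y; exact hqA' _ (hAle (hPm y))
    -- The range of d complements that of q in that of q'. Only q' q = q is available, so q' - q
    -- need not be idempotent, whereas (1 - q) q' is.
    set d : Module.End R X := (1 - q) * q'
    have hqd : q * d = 0 := by
      rw [← mul_assoc, mul_sub, mul_one, h1, sub_self, zero_mul]
    have hd : IsIdempotentElem d := by
      unfold IsIdempotentElem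
      calc d * d = (1 - q) * (q' * d) := mul_assoc _ _ _
        _ = (1 - q) * d := by
            have : q' * d = q' - q * q' := by
              rw [← mul_assoc, mul_sub, mul_one, sub_mul, h3, h2]
            rw [this]
            have : d = q' - q * q' := by simp only [d, sub_mul, one_mul]
            rw [← this]
        _ = d := by rw [sub_mul, one_mul, hqd, sub_zero]
    -- As d kills A, its range is already the image of the part indexed by the countable set C.
    have hdC : (⨆ i ∈ C, N i).map d = LinearMap.range d := by
      apply le_antisymm LinearMap.map_le_range
      rintro _ ⟨y, rfl⟩
      have hdP : d (P' y) = d y := by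
        simp only [d, Module.End.mul_apply, hq', hPA' _ (hPm' y)]
      have hy := hPm' y
      rw [hAA', Submodule.mem_sup] at hy
      obtain ⟨a, ha, b, hb, hab⟩ := hy
      refine ⟨b, hb, ?_⟩
      have hda : d a = 0 := by
        simp only [d, Module.End.mul_apply, hq', hPA' _ (hAle ha), LinearMap.sub_apply,
          Module.End.one_apply, hqA a ha, sub_self]
      rw [← hdP, ← hab, map_add, hda, zero_add]
    obtain ⟨x, hx⟩ := Submodule.exists_seq_span_eq_biSup hCc hfin
    obtain ⟨B, hBind, hBsup, hBfin⟩ := exists_iSupIndep_fg_of_countable hloc hex hd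
      (x := fun n => d (x n)) (by
        rw [← hdC, ← hx, Submodule.map_span, ← Set.range_comp]
        rfl)
    have hrq : A.map e = LinearMap.range q := by
      apply le_antisymm
      · rintro _ ⟨y, hy, rfl⟩
        exact ⟨y, by rw [hq, hPA y hy]⟩
      · rintro _ ⟨y, rfl⟩
        exact ⟨P y, hPm y, rfl⟩
    have hrq' : A'.map e = LinearMap.range q' := by
      apply le_antisymm
      · rintro _ ⟨y, hy, rfl⟩
        exact ⟨y, by rw [hq', hPA' y hy]⟩
      · rintro _ ⟨y, rfl⟩
        exact ⟨P' y, hPm' y, rfl⟩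
    have hdisj : Disjoint (sSup 𝒮) (sSup (Set.range B)) := by
      rw [sSup_range, hBsup, hsup, hrq, Submodule.disjoint_def]
      rintro _ ⟨y, rfl⟩ ⟨z, hz⟩
      have e1 : q (q y) = q y := LinearMap.congr_fun h1 y
      have e2 : q (d z) = 0 := LinearMap.congr_fun hqd z
      rw [← e1, ← hz, e2]
    have hnew : (J', 𝒮 ∪ Set.range B) ∈ Z := by
      refine ⟨hJ', hind.union hBind.sSupIndep_range hdisj, ?_, ?_⟩
      · change sSup (𝒮 ∪ Set.range B) = A'.map e
        rw [sSup_union, hsup, sSup_range, hBsup, hrq, hrq']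
        apply le_antisymm
        · refine sup_le ?_ ?_
          · rw [← h3]; exact LinearMap.range_comp_le_range _ _
          · rintro _ ⟨y, rfl⟩
            refine sub_mem (LinearMap.mem_range_self q' y) ?_
            rw [hq, hq', ← hrq']
            exact Submodule.mem_map_of_mem (hAle (hPm _))
        · rintro _ ⟨y, rfl⟩
          have : q' y = q (q' y) + d y := by
            simp [d]
          rw [this]
          exact Submodule.add_mem_sup (LinearMap.mem_range_self _ _) (LinearMap.mem_range_self _ _)
      · rintro D (hD | ⟨n, rfl⟩)
        · exact hfg D hD
        · exact hBfin n
    have hle := hmax hnew ⟨Set.subset_union_left, Set.subset_union_left⟩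
    exact hi (hle.1 (Set.mem_union_right _ hiC))
  refine ⟨𝒮, fun B => B, (sSupIndep_iff _).mp hind, ?_, fun B => hfg B B.2⟩
  rw [← sSup_eq_iSup', hsup, hJuniv]
  simp only [Set.mem_univ, iSup_pos, htop, Submodule.map_top, herange]

end Summands

/-! ### Summands with local endomorphism rings; the rank one case -/

theorem IsLocalRing.exists_isUnit_of_isUnit_sum {T : Type*} [Ring T] [IsLocalRing T] {ι : Type*}
    (s : Finset ι) (f : ι → T) (h : IsUnit (∑ i ∈ s, f i)) : ∃ i ∈ s, IsUnit (f i) := by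
  classical
  induction s using Finset.induction_on with
  | empty => simp at h
  | insert a s ha ih =>
    rw [Finset.sum_insert ha] at h
    obtain ⟨w, hw⟩ := h
    have h1 : (↑w⁻¹ : T) * f a + ↑w⁻¹ * ∑ i ∈ s, f i = 1 := by
      rw [← mul_add, ← hw, Units.inv_mul]
    rcases IsLocalRing.isUnit_or_isUnit_of_add_one h1 with h | h
    · exact ⟨a, Finset.mem_insert_self _ _, (Units.isUnit_units_mul _ _).mp h⟩
    · obtain ⟨i, hi, hu⟩ := ih ((Units.isUnit_units_mul _ _).mp h)
      exact ⟨i, Finset.mem_insert_of_mem hi, hu⟩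

section Projections

variable {R : Type u} [CommRing R] {X : Type v} [AddCommGroup X] [Module R X]

/-- The projections belonging to an internal direct sum. -/
theorem iSupIndep.exists_projections {ι : Type*} {N : ι → Submodule R X} (hN : iSupIndep N)
    (htop : ⨆ i, N i = ⊤) : ∃ p : ι → Module.End R X, (∀ i x, p i x ∈ N i) ∧
      (∀ i, ∀ x ∈ N i, p i x = x) ∧ (∀ i j, i ≠ j → ∀ x ∈ N j, p i x = 0) ∧
      ∀ (F : Finset ι), ∀ x ∈ ⨆ i ∈ F, N i, ∑ i ∈ F, p i x = x := by
  classical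
  have hc : ∀ i, IsCompl (N i) (⨆ j ∈ ({i} : Set ι)ᶜ, N j) := fun i => by
    have := hN.isCompl_biSup_compl htop {i}
    simpa only [Set.mem_singleton_iff, iSup_iSup_eq_left] using this
  have h1 : ∀ i, ∀ x ∈ N i, (N i).projection _ (hc i) x = x := fun i x hx =>
    Submodule.projection_apply_of_mem_left _ hx
  have h2 : ∀ i j, i ≠ j → ∀ x ∈ N j, (N i).projection _ (hc i) x = 0 := by
    intro i j hij x hx
    rw [Submodule.projection_apply, ZeroMemClass.coe_eq_zero,
      Submodule.projectionOnto_apply_eq_zero_iff]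
    exact le_biSup N (i := j) (s := ({i} : Set ι)ᶜ) (fun h => hij h.symm) hx
  refine ⟨fun i => (N i).projection _ (hc i), fun i x => Submodule.projection_apply_mem _ x,
    h1, h2, ?_⟩
  intro F x hx
  have hle : ⨆ i ∈ F, N i ≤
      LinearMap.eqLocus (∑ i ∈ F, (N i).projection _ (hc i)) LinearMap.id := by
    refine iSup₂_le fun k hk y hy => ?_
    rw [LinearMap.mem_eqLocus, LinearMap.sum_apply, LinearMap.id_apply,
      Finset.sum_eq_single_of_mem k hk fun i _ hik => h2 i k hik y hy, h1 k y hy]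
  have := hle hx
  rwa [LinearMap.mem_eqLocus, LinearMap.sum_apply] at this

theorem iSupIndep.isTorsionFree [IsDomain R] {ι : Type*} {N : ι → Submodule R X}
    (hN : iSupIndep N) (htop : ⨆ i, N i = ⊤) (h : ∀ i, Module.IsTorsionFree R (N i)) :
    Module.IsTorsionFree R X := by
  obtain ⟨p, hp, -, -, hsum⟩ := hN.exists_projections htop
  refine Module.IsTorsionFree.of_smul_eq_zero fun r x hrx => ?_
  by_cases hr : r = 0
  · exact .inl hr
  right
  have hx : x ∈ ⨆ i, N i := by rw [htop]; trivial
  obtain ⟨F, hF⟩ := Submodule.mem_iSup_iff_exists_finset.mp hx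
  rw [← hsum F x hF]
  refine Finset.sum_eq_zero fun i _ => ?_
  have h1 : r • (⟨p i x, hp i x⟩ : N i) = 0 := by
    ext
    change r • p i x = 0
    rw [← map_smul, hrx, map_zero]
  exact congrArg Subtype.val ((smul_eq_zero_iff_right hr).mp h1)

/-- A summand with local endomorphism ring of a direct sum embeds into one of the summands. -/
theorem iSupIndep.exists_injective_of_isLocalRing_end {ι : Type*} {N : ι → Submodule R X}
    (hN : iSupIndep N) (htop : ⨆ i, N i = ⊤) {L : Submodule R X} (hL : IsComplemented L)
    (hfin : Module.Finite R L) (hloc : IsLocalRing (Module.End R L)) :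
    ∃ i, ∃ f : L →ₗ[R] N i, Function.Injective f := by
  obtain ⟨p, hp, -, -, hsum⟩ := hN.exists_projections htop
  obtain ⟨L', hLL'⟩ := hL
  let π : X →ₗ[R] L := L.projectionOnto L' hLL'
  have hLc : IsCompactElement L := (Submodule.fg_iff_compact _).mp (Module.Finite.iff_fg.mp hfin)
  obtain ⟨F, hF⟩ := CompleteLattice.IsCompactElement.exists_finset_of_le_iSup _ hLc N
    (by rw [htop]; exact le_top)
  -- The identity of L is the finite sum of its passages through the N i; in a local ring one term
  -- must be a unit, so the passage through that N i is injective.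
  have hid : ∑ i ∈ F, (π ∘ₗ p i ∘ₗ L.subtype : Module.End R L) = 1 := by
    ext1 x
    rw [LinearMap.sum_apply]
    simp only [LinearMap.comp_apply, ← map_sum]
    have : ∑ i ∈ F, p i (L.subtype x) = x := hsum F x (hF x.2)
    rw [this]
    exact Submodule.projectionOnto_apply_left hLL' x
  obtain ⟨i, -, hi⟩ := IsLocalRing.exists_isUnit_of_isUnit_sum F
    (fun i => (π ∘ₗ p i ∘ₗ L.subtype : Module.End R L)) (by rw [hid]; exact isUnit_one)
  refine ⟨i, (p i ∘ₗ L.subtype).codRestrict (N i) fun x => hp i _, ?_⟩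
  have hinj := ((Module.End.isUnit_iff _).mp hi).injective
  intro x y hxy
  apply hinj
  have h1 : p i x = p i y := congrArg Subtype.val hxy
  change π (p i x) = π (p i y)
  rw [h1]

/-- The finitely generated pieces are refined to pieces with local endomorphism rings. Each of these
is nonzero and embeds into some N j, hence has rank one. -/
theorem Submodule.decomposesInto_rankOne_of_isComplemented [IsDomain R] {ι : Type*}
    {N : ι → Submodule R X}
    (hN : iSupIndep N) (htop : ⨆ i, N i = ⊤) (hfin : ∀ i, Module.Finite R (N i))
    (htf : Module.IsTorsionFree R X) (hone : ∀ i, Module.finrank R (N i) = 1)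
    (hex : ∀ B : Submodule R X, Module.Finite R B → IsExchangeRing (Module.End R B))
    (K : Submodule R X) (hK : IsComplemented K) :
    K.DecomposesInto fun B => Module.Finite R B ∧ Module.finrank R B = 1 := by
  obtain ⟨κ, B, hB, hBK, hBfin⟩ :=
    Submodule.decomposesInto_fg_of_isComplemented hN htop hfin hex K hK
  have hdec : K.DecomposesInto fun L => Module.Finite R L ∧ IsLocalRing (Module.End R L) := by
    rw [← hBK]
    exact Submodule.DecomposesInto.iSup hB fun i =>
      Submodule.decomposesInto_localEnd hex _ (hBfin i)
  obtain ⟨κ, L, hL, hLK, hLP⟩ := hdec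
  refine ⟨κ, L, hL, hLK, fun i => ⟨(hLP i).1, ?_⟩⟩
  have hLf := (hLP i).1
  have hLl := (hLP i).2
  have hcompl : IsComplemented (L i) := by
    obtain ⟨K', hK'⟩ := hK
    refine ⟨(⨆ j, ⨆ (_ : j ≠ i), L j) ⊔ K', ?_, ?_⟩
    · refine Disjoint.disjoint_sup_right_of_disjoint_sup_left (hL i) ?_
      refine hK'.disjoint.mono_left ?_
      rw [← hLK]
      exact sup_le (le_iSup L i) (iSup₂_le fun j _ => le_iSup L j)
    · rw [codisjoint_iff, ← sup_assoc, eq_top_iff, ← hK'.sup_eq_top, ← hLK]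
      refine sup_le_sup_right (iSup_le fun j => ?_) _
      by_cases hj : j = i
      · rw [hj]; exact le_sup_left
      · exact (le_iSup₂_of_le (f := fun j (_ : j ≠ i) => L j) j hj le_rfl).trans le_sup_right
  obtain ⟨j, f, hf⟩ := hN.exists_injective_of_isLocalRing_end htop hcompl hLf hLl
  have := hfin j
  apply le_antisymm
  · rw [← hone j]
    exact LinearMap.finrank_le_finrank_of_injective hf
  · have : Nontrivial (L i) := by
      by_contra h
      rw [not_nontrivial_iff_subsingleton] at h
      exact zero_ne_one (Subsingleton.elim (0 : Module.End R (L i)) 1)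
    exact Module.finrank_pos

end Projections

/-! ### The Krull–Akizuki theorem for overrings in the fraction field -/

/-- The key finiteness statement behind the Krull–Akizuki theorem. -/
theorem exists_pow_mul_eq_add {R : Type*} [CommRing R] [IsDomain R] [IsNoetherianRing R]
    [Ring.DimensionLEOne R] {Q : Type*} [Field Q] [Algebra R Q] [IsFractionRing R Q]
    (V : Subalgebra R Q) {a : R} (ha : a ≠ 0) :
    ∃ l : ℕ, ∀ x ∈ V, ∃ b : R, ∃ v ∈ V, algebraMap R Q a ^ l * x =
      algebraMap R Q b + algebraMap R Q a ^ (l + 1) * v := by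
  set f := algebraMap R Q
  have hfa : f a ≠ 0 := by
    rw [Ne, FaithfulSMul.algebraMap_eq_zero_iff]; exact ha
  have hfl : ∀ c : R, c ≠ 0 → IsArtinian R (R ⧸ Ideal.span {c}) := fun c hc =>
    (isFiniteLength_iff_isNoetherian_isArtinian.mp
      (isFiniteLength_quotient_span_singleton R (mem_nonZeroDivisors_of_ne_zero hc))).2
  have hVR : ∀ b : R, f b ∈ V := fun b => V.algebraMap_mem b
  -- For a single x = b / c, the powers of a stabilise in the artinian R / c, say aⁿ ≡ aⁿ⁺¹ y.
  -- Multiplying by x gives the claim with an n depending on x.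
  have hstart : ∀ x ∈ V, ∃ n : ℕ, ∃ b : R, ∃ v ∈ V, f a ^ n * x = f b + f a ^ (n + 1) * v := by
    intro x hx
    obtain ⟨b, c, hc, hbc⟩ := IsFractionRing.div_surjective (A := R) x
    have hc0 : c ≠ 0 := nonZeroDivisors.ne_zero hc
    have hfc : f c ≠ 0 := by
      rw [Ne, FaithfulSMul.algebraMap_eq_zero_iff]; exact hc0
    have hfx : f b = f c * x := by rw [← hbc]; exact (mul_div_cancel₀ _ hfc).symm
    have := hfl c hc0
    obtain ⟨n, y, hy⟩ := IsArtinian.exists_pow_succ_smul_dvd a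
      (Ideal.Quotient.mk (Ideal.span {c}) 1)
    obtain ⟨y, rfl⟩ := Ideal.Quotient.mk_surjective y
    have hmem : a ^ (n + 1) * y - a ^ n ∈ Ideal.span {c} := by
      rw [← Ideal.Quotient.mk_eq_mk_iff_sub_mem]
      have := hy
      simp only [Algebra.smul_def, Ideal.Quotient.algebraMap_eq, ← map_mul, mul_one] at this
      exact this
    obtain ⟨z, hz⟩ := Ideal.mem_span_singleton'.mp hmem
    refine ⟨n, -(z * b), f y * x, mul_mem (hVR y) hx, ?_⟩
    have hz' : f z * f c = f a ^ (n + 1) * f y - f a ^ n := by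
      rw [← map_mul, hz]; simp
    rw [map_neg, map_mul]
    linear_combination x * hz' + f z * hfx
  have := hfl a ha
  -- The ideals R ∩ aⁿV have a stable image in the artinian R / a from some l on. This l lets n be
  -- lowered to l for every x, which makes the exponent uniform.
  let I : ℕ → Ideal R := fun n =>
    { carrier := {b | ∃ v ∈ V, f b = f a ^ n * v}
      add_mem' := by
        rintro b b' ⟨v, hv, h⟩ ⟨v', hv', h'⟩
        exact ⟨v + v', add_mem hv hv', by rw [map_add, h, h']; ring⟩
      zero_mem' := ⟨0, zero_mem _, by simp⟩
      smul_mem' := by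
        rintro c b ⟨v, hv, h⟩
        exact ⟨f c * v, mul_mem (hVR c) hv, by rw [smul_eq_mul, map_mul, h]; ring⟩ }
  have hI : Antitone I := antitone_nat_of_succ_le fun n => by
    rintro b ⟨v, hv, h⟩
    exact ⟨f a * v, mul_mem (hVR a) hv, by rw [h]; ring⟩
  obtain ⟨l, hl⟩ := IsArtinian.monotone_stabilizes
    (⟨fun n => OrderDual.toDual (Submodule.map (Ideal.span {a}).mkQ (I n)),
      fun m n hmn => Submodule.map_mono (hI hmn)⟩ :
      ℕ →o (Submodule R (R ⧸ Ideal.span {a}))ᵒᵈ)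
  have hl' : ∀ n, l ≤ n → ∀ b ∈ I n, ∃ b' ∈ I (n + 1), b - b' ∈ Ideal.span {a} := by
    intro n hn b hb
    have h1 : Submodule.map (Ideal.span {a}).mkQ (I n) =
        Submodule.map (Ideal.span {a}).mkQ (I (n + 1)) :=
      (hl n hn).symm.trans (hl (n + 1) (by omega))
    have h2 : (Ideal.span {a}).mkQ b ∈ Submodule.map (Ideal.span {a}).mkQ (I (n + 1)) := by
      rw [← h1]; exact Submodule.mem_map_of_mem hb
    obtain ⟨b', hb', hbb⟩ := h2
    exact ⟨b', hb', (Submodule.Quotient.eq _).mp hbb.symm⟩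
  let P : Q → ℕ → Prop := fun x n => ∃ b : R, ∃ v ∈ V, f a ^ n * x = f b + f a ^ (n + 1) * v
  have hup : ∀ x n, P x n → P x (n + 1) := by
    rintro x n ⟨b, v, hv, h⟩
    exact ⟨a * b, v, hv, by rw [map_mul, pow_succ, mul_right_comm, h]; ring⟩
  have hdown : ∀ x ∈ V, ∀ n, l ≤ n → P x (n + 1) → P x n := by
    rintro x hx n hn ⟨b, v, hv, h⟩
    obtain ⟨b', ⟨v', hv', h'⟩, hbb⟩ := hl' (n + 1) (by omega) b
      ⟨x - f a * v, sub_mem hx (mul_mem (hVR a) hv), by linear_combination -h⟩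
    obtain ⟨b'', hb''⟩ := Ideal.mem_span_singleton'.mp hbb
    refine ⟨b'', v' + v, add_mem hv' hv, ?_⟩
    apply mul_left_cancel₀ hfa
    have e1 : f b'' * f a = f b - f b' := by rw [← map_mul, hb'', map_sub]
    linear_combination h + h' - e1
  refine ⟨l, fun x hx => ?_⟩
  obtain ⟨n, hn⟩ := hstart x hx
  have hall : ∀ m, P x (l + m) → P x l := by
    intro m
    induction m with
    | zero => exact id
    | succ m ih => exact fun h => ih (hdown x hx (l + m) (by omega) h)
  refine hall n ?_
  have : ∀ m, P x (n + m) := fun m => by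
    induction m with
    | zero => exact hn
    | succ m ih => exact hup x _ ih
  rw [add_comm]
  exact this l

/-- **Krull–Akizuki** for subrings of the field of fractions. -/
theorem isNoetherianRing_of_subalgebra_fractionRing {R : Type*} [CommRing R] [IsDomain R]
    [IsNoetherianRing R]
    [Ring.DimensionLEOne R] {Q : Type*} [Field Q] [Algebra R Q] [IsFractionRing R Q]
    (V : Subalgebra R Q) : IsNoetherianRing V := by
  rw [isNoetherianRing_iff_ideal_fg]
  intro I
  by_cases hI : I = ⊥
  · rw [hI]; exact Submodule.fg_bot
  obtain ⟨x, hxI, hx0⟩ := Submodule.exists_mem_ne_zero_of_ne_bot hI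
  obtain ⟨a, c, hc, hac⟩ := IsFractionRing.div_surjective (A := R) (x : Q)
  have hc0 : algebraMap R Q c ≠ 0 := by
    rw [Ne, FaithfulSMul.algebraMap_eq_zero_iff]; exact nonZeroDivisors.ne_zero hc
  have hcx : algebraMap R V a = algebraMap R V c * x := by
    ext
    change algebraMap R Q a = algebraMap R Q c * x
    rw [← hac]; field_simp
  have haI : algebraMap R V a ∈ I := hcx ▸ I.mul_mem_left _ hxI
  have ha0 : a ≠ 0 := by
    rintro rfl
    apply hx0
    ext
    rw [← hac]; simp
  obtain ⟨l, hl⟩ := exists_pow_mul_eq_add V ha0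
  -- T collects the R-parts of aˡ x for x ∈ I. An element of I whose R-part equals that of an
  -- element of J differs from it by a multiple of a, so generators of T together with a yield
  -- generators of I.
  let T : Ideal R :=
    { carrier := {b | ∃ x ∈ I, ∃ v : V, algebraMap R V a ^ l * x =
        algebraMap R V b + algebraMap R V a ^ (l + 1) * v}
      add_mem' := by
        rintro b b' ⟨x, hx, v, h⟩ ⟨x', hx', v', h'⟩
        exact ⟨x + x', add_mem hx hx', v + v', by rw [mul_add, h, h', map_add]; ring⟩
      zero_mem' := ⟨0, zero_mem _, 0, by simp⟩
      smul_mem' := by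
        rintro c b ⟨x, hx, v, h⟩
        exact ⟨algebraMap R V c * x, I.mul_mem_left _ hx, algebraMap R V c * v, by
          rw [smul_eq_mul, map_mul]; linear_combination algebraMap R V c * h⟩ }
  obtain ⟨s, hs⟩ := (isNoetherianRing_iff_ideal_fg R).mp inferInstance T
  have hsT : ∀ b : s, (b : R) ∈ T := fun b => hs ▸ Submodule.subset_span b.2
  choose g hgI w hw using hsT
  have hfa : algebraMap R V a ≠ 0 := by
    rw [Ne, FaithfulSMul.algebraMap_eq_zero_iff]; exact ha0
  set J : Ideal V := Ideal.span (insert (algebraMap R V a) (Set.range g))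
  have hJ : J.FG := Submodule.fg_span ((Set.finite_range g).insert _)
  have haJ : algebraMap R V a ∈ J := Ideal.subset_span (Set.mem_insert _ _)
  have hgJ : ∀ b, g b ∈ J := fun b =>
    Ideal.subset_span (Set.mem_insert_of_mem _ (Set.mem_range_self b))
  have hJI : J ≤ I := by
    rw [Ideal.span_le]
    rintro _ (rfl | ⟨b, rfl⟩)
    · exact haI
    · exact hgI b
  have hTJ : ∀ b ∈ T, ∃ y ∈ J, ∃ v : V, algebraMap R V a ^ l * y =
      algebraMap R V b + algebraMap R V a ^ (l + 1) * v := by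
    intro b hb
    rw [← hs] at hb
    induction hb using Submodule.span_induction with
    | mem b hb => exact ⟨g ⟨b, hb⟩, hgJ _, w ⟨b, hb⟩, hw ⟨b, hb⟩⟩
    | zero => exact ⟨0, zero_mem _, 0, by simp⟩
    | add b b' _ _ h h' =>
      obtain ⟨y, hy, v, h⟩ := h
      obtain ⟨y', hy', v', h'⟩ := h'
      exact ⟨y + y', add_mem hy hy', v + v', by rw [mul_add, h, h', map_add]; ring⟩
    | smul c b _ h =>
      obtain ⟨y, hy, v, h⟩ := h
      exact ⟨algebraMap R V c * y, J.mul_mem_left _ hy, algebraMap R V c * v, by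
          rw [smul_eq_mul, map_mul]; linear_combination algebraMap R V c * h⟩
  have hIJ : I ≤ J := by
    intro x hx
    obtain ⟨b, v, hv, h⟩ := hl x x.2
    have h' : algebraMap R V a ^ l * x =
        algebraMap R V b + algebraMap R V a ^ (l + 1) * ⟨v, hv⟩ := Subtype.ext h
    obtain ⟨y, hy, v', h''⟩ := hTJ b ⟨x, hx, _, h'⟩
    have : x = y + algebraMap R V a * (⟨v, hv⟩ - v') := by
      apply mul_left_cancel₀ (pow_ne_zero l hfa)
      linear_combination h' - h''
    rw [this]
    exact add_mem hy (J.mul_mem_right _ haJ)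
  rw [le_antisymm hIJ hJI]
  exact hJ

theorem isDiscreteValuationRing_integralClosure {R : Type*} [CommRing R] [IsDomain R]
    [IsNoetherianRing R] [Ring.DimensionLEOne R] (hR : ¬ IsField R) {Q : Type*} [Field Q]
    [Algebra R Q] [IsFractionRing R Q] (h : IsLocalRing (integralClosure R Q)) :
    IsDiscreteValuationRing (integralClosure R Q) := by
  have hN : IsNoetherianRing (integralClosure R Q) := isNoetherianRing_of_subalgebra_fractionRing _
  have hic : IsIntegrallyClosed (integralClosure R Q) :=
    integralClosure.isIntegrallyClosedOfFiniteExtension Q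
  have hF : ¬ IsField (integralClosure R Q) := fun hF =>
    hR (isField_of_isIntegral_of_isField (FaithfulSMul.algebraMap_injective R _) hF)
  have hded : IsDedekindDomain (integralClosure R Q) :=
    { hN, (inferInstance : IsDomain (integralClosure R Q)), hic,
      (inferInstance : Ring.DimensionLEOne (integralClosure R Q)) with }
  exact ((IsDiscreteValuationRing.TFAE _ hF).out 0 2).mpr hded

/-! ### Tail sums, twisted sequences and an idempotent with prescribed corner -/

section Finsupp

variable {R S : Type*} [CommRing R] [CommRing S] [Algebra R S]

theorem Finsupp.linearCombination_mapRange_algebraMap {ι M : Type*} [AddCommGroup M] [Module R M]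
    [Module S M] [IsScalarTower R S M] (v : ι → M) (x : ι →₀ R) :
    Finsupp.linearCombination S v (Finsupp.mapRange.linearMap (Algebra.linearMap R S) x) =
      Finsupp.linearCombination R v x := by
  rw [Finsupp.linearCombination_apply, Finsupp.linearCombination_apply,
    Finsupp.mapRange.linearMap_apply, Finsupp.sum_mapRange_index (h := fun i a => a • v i) fun i => zero_smul S (v i)]
  simp only [Algebra.linearMap_apply, algebraMap_smul]

/-- A linear map to `ι →₀ S` all of whose coordinates come from `R` lifts to `ι →₀ R`. -/
theorem LinearMap.exists_lift_finsupp {ι P : Type*} [AddCommGroup P] [Module R P]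
    (hf : Function.Injective (algebraMap R S)) (g : P →ₗ[R] (ι →₀ S))
    (hg : ∀ p i, ∃ x : R, algebraMap R S x = g p i) :
    ∃ g' : P →ₗ[R] (ι →₀ R), ∀ p,
      Finsupp.mapRange.linearMap (Algebra.linearMap R S) (g' p) = g p := by
  set F : (ι →₀ R) →ₗ[R] (ι →₀ S) := Finsupp.mapRange.linearMap (Algebra.linearMap R S)
  have hF : Function.Injective F := Finsupp.mapRange_injective _ (map_zero _) hf
  have hr : ∀ p, g p ∈ LinearMap.range F := by
    intro p
    choose x hx using hg p
    refine ⟨Finsupp.onFinset (g p).support x fun i hi => ?_, ?_⟩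
    · rw [Finsupp.mem_support_iff, ← hx]
      exact fun h => hi (hf (by rw [h, map_zero]))
    · ext i
      simp only [F, Finsupp.mapRange.linearMap_apply, Finsupp.mapRange_apply,
        Finsupp.onFinset_apply, Algebra.linearMap_apply, hx]
  refine ⟨(LinearEquiv.ofInjective F hF).symm.toLinearMap ∘ₗ g.codRestrict _ hr, fun p => ?_⟩
  exact congrArg Subtype.val ((LinearEquiv.ofInjective F hF).apply_symm_apply
    (g.codRestrict _ hr p))

/-- The tail sums `m ↦ ∑_{j ≥ m} κ j`. -/
noncomputable def Finsupp.tailSum (S : Type*) [CommRing S] : (ℕ →₀ S) →ₗ[S] (ℕ →₀ S) :=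
  Finsupp.lsum S fun j => ∑ m ∈ Finset.range (j + 1), Finsupp.lsingle m

theorem Finsupp.tailSum_single (j : ℕ) (y : S) (m : ℕ) :
    Finsupp.tailSum S (Finsupp.single j y) m = if m ≤ j then y else 0 := by
  simp [Finsupp.tailSum, Finsupp.single_apply, Finsupp.finsetSum_apply]

theorem Finsupp.tailSum_apply (κ : ℕ →₀ S) (m : ℕ) :
    Finsupp.tailSum S κ m = κ m + Finsupp.tailSum S κ (m + 1) := by
  induction κ using Finsupp.induction_linear with
  | zero => simp
  | add f g hf hg => rw [map_add, Finsupp.add_apply, Finsupp.add_apply, Finsupp.add_apply, hf, hg]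
                     ring
  | single j y =>
    simp only [Finsupp.tailSum_single, Finsupp.single_apply]
    rcases lt_trichotomy m j with h | h | h
    · simp [h.le, h.ne', Nat.succ_le_of_lt h]
    · simp [h]
    · simp [h.not_ge, h.ne, show ¬ m + 1 ≤ j by omega]

/-- The sequence `e_m - a e_{m+1}`. -/
noncomputable def Finsupp.stepVec (a : S) (m : ℕ) : ℕ →₀ S :=
  Finsupp.single m 1 - Finsupp.single (m + 1) a

theorem Finsupp.linearCombination_stepVec_zero (a : S) (s : ℕ →₀ S) :
    Finsupp.linearCombination S (Finsupp.stepVec a) s 0 = s 0 := by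
  induction s using Finsupp.induction_linear with
  | zero => simp
  | add f g hf hg => rw [map_add, Finsupp.add_apply, Finsupp.add_apply, hf, hg]
  | single j y => simp [Finsupp.stepVec, Finsupp.single_apply]

theorem Finsupp.linearCombination_stepVec_succ (a : S) (s : ℕ →₀ S) (m : ℕ) :
    Finsupp.linearCombination S (Finsupp.stepVec a) s (m + 1) = s (m + 1) - a * s m := by
  induction s using Finsupp.induction_linear with
  | zero => simp
  | add f g hf hg =>
    rw [LinearMap.map_add, Finsupp.add_apply, Finsupp.add_apply, Finsupp.add_apply, hf, hg]
    ring
  | single j y =>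
    simp only [Finsupp.linearCombination_single, Finsupp.stepVec, Finsupp.smul_apply,
      Finsupp.sub_apply, Finsupp.single_apply, smul_eq_mul, add_left_inj]
    split_ifs <;> ring

theorem Finsupp.linearCombination_single_succ_zero (t : ℕ →₀ S) :
    Finsupp.linearCombination S (fun m : ℕ => Finsupp.single (m + 1) (1 : S)) t 0 = 0 := by
  induction t using Finsupp.induction_linear with
  | zero => simp
  | add f g hf hg => rw [map_add, Finsupp.add_apply, hf, hg, add_zero]
  | single j y => simp

theorem Finsupp.linearCombination_single_succ_succ (t : ℕ →₀ S) (m : ℕ) :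
    Finsupp.linearCombination S (fun m : ℕ => Finsupp.single (m + 1) (1 : S)) t (m + 1) = t m := by
  induction t using Finsupp.induction_linear with
  | zero => simp
  | add f g hf hg => rw [LinearMap.map_add, Finsupp.add_apply, Finsupp.add_apply, hf, hg]
  | single j y => simp [Finsupp.single_apply]

/-- Every finitely supported sequence is a combination of the standard ones; here `c = a² - a`. -/
theorem Finsupp.eq_single_sub_stepVec (a : S) (κ : ℕ →₀ S) :
    κ = Finsupp.single 0 (a * Finsupp.tailSum S κ 0) +
      Finsupp.linearCombination S (Finsupp.stepVec a) (κ - a • Finsupp.tailSum S κ) +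
      Finsupp.linearCombination S (fun m : ℕ => Finsupp.single (m + 1) (1 : S))
        (-((a ^ 2 - a) • Finsupp.tailSum S κ)) := by
  ext m
  rw [Finsupp.add_apply, Finsupp.add_apply]
  cases m with
  | zero =>
    rw [Finsupp.linearCombination_stepVec_zero, Finsupp.linearCombination_single_succ_zero]
    simp
  | succ m =>
    rw [Finsupp.linearCombination_stepVec_succ, Finsupp.linearCombination_single_succ_succ]
    have h := Finsupp.tailSum_apply κ m
    simp only [Finsupp.single_apply, Finsupp.sub_apply, Finsupp.smul_apply, Finsupp.neg_apply,
      smul_eq_mul]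
    rw [if_neg (by omega)]
    linear_combination (-a) * h

end Finsupp

/-- Sequences `κ` in `S` with `κ (m+1) - b κ m ∈ R` for all `m`. -/
def twistedSequences (R : Type*) {S : Type*} [CommRing R] [CommRing S] [Algebra R S] (b : S) :
    Submodule R (ℕ →₀ S) where
  carrier := {κ | ∀ m, ∃ x : R, algebraMap R S x = κ (m + 1) - b * κ m}
  add_mem' := by
    intro κ κ' h h' m
    obtain ⟨x, hx⟩ := h m
    obtain ⟨x', hx'⟩ := h' m
    exact ⟨x + x', by rw [map_add, hx, hx', Finsupp.add_apply, Finsupp.add_apply]; ring⟩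
  zero_mem' := fun m => ⟨0, by simp⟩
  smul_mem' := by
    intro r κ h m
    obtain ⟨x, hx⟩ := h m
    exact ⟨r * x, by
      rw [map_mul, hx, Finsupp.smul_apply, Finsupp.smul_apply, Algebra.smul_def, Algebra.smul_def]
      ring⟩

section Twisted

variable {R S : Type*} [CommRing R] [CommRing S] [Algebra R S] {a : S}

/-- The error term (1 - a)a = -(a² - a) is the reason for twisting by 1 - a: all else is integral,
and a² - a will lie in the conductor. -/
theorem stepVec_diff (m q : ℕ) :
    Finsupp.stepVec a q (m + 1) - (1 - a) * Finsupp.stepVec a q m =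
      (if q = m + 1 then 1 else 0) - (if q = m then 1 else 0) -
        (a ^ 2 - a) * (if q + 1 = m then 1 else 0) := by
  simp only [Finsupp.stepVec, Finsupp.sub_apply, Finsupp.single_apply, add_left_inj]
  split_ifs <;> first | omega | ring

/-- The 0-1 terms telescope, leaving only the end p and multiples of a² - a. -/
theorem sum_stepVec_diff (m p : ℕ) : ∃ z : S,
    (∑ q ∈ Finset.range (p + 1), Finsupp.stepVec a q) (m + 1) -
      (1 - a) * (∑ q ∈ Finset.range (p + 1), Finsupp.stepVec a q) m =
      -(if p = m then 1 else 0) - (a ^ 2 - a) * z := by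
  induction p with
  | zero =>
    refine ⟨if 0 + 1 = m then 1 else 0, ?_⟩
    have h := stepVec_diff (a := a) m 0
    rw [if_neg (by omega)] at h
    rw [zero_add, Finset.sum_range_one]
    linear_combination h
  | succ p ih =>
    obtain ⟨z, hz⟩ := ih
    refine ⟨z + if p + 1 + 1 = m then 1 else 0, ?_⟩
    rw [Finset.sum_range_succ, Finsupp.add_apply, Finsupp.add_apply]
    have h := stepVec_diff (a := a) m (p + 1)
    simp only [add_left_inj] at h
    linear_combination hz + h

theorem stepVec_mem_twistedSequences {c : R} (hc : algebraMap R S c = a ^ 2 - a) (q : ℕ) :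
    Finsupp.stepVec a q ∈ twistedSequences R (1 - a) := by
  intro m
  rw [stepVec_diff, ← hc]
  exact ⟨(if q = m + 1 then 1 else 0) - (if q = m then 1 else 0) -
    c * (if q + 1 = m then 1 else 0), by split_ifs <;> simp⟩

theorem single_mem_twistedSequences {c : R} (hc : algebraMap R S c = a ^ 2 - a)
    (hcS : ∀ y : S, ∃ x : R, algebraMap R S x = algebraMap R S c * y) (y : S) :
    Finsupp.single 0 (a * y) ∈ twistedSequences R (1 - a) := by
  intro m
  cases m with
  | zero =>
    obtain ⟨x, hx⟩ := hcS y
    refine ⟨x, ?_⟩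
    rw [hx, hc]
    simp only [Finsupp.single_apply]
    rw [if_neg (by omega), if_true]
    ring
  | succ m => exact ⟨0, by simp⟩

/-- The basis vector at p violates the twisted condition only by -(1 - a) at m = p, and subtracting
(1 - a) times the telescoping sum cancels this. -/
theorem single_sub_mem_twistedSequences {c : R} (hc : algebraMap R S c = a ^ 2 - a)
    (hcS : ∀ y : S, ∃ x : R, algebraMap R S x = algebraMap R S c * y) (p : ℕ) :
    Finsupp.single p 1 - (1 - a) • ∑ q ∈ Finset.range (p + 1), Finsupp.stepVec a q ∈
      twistedSequences R (1 - a) := by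
  intro m
  obtain ⟨z, hz⟩ := sum_stepVec_diff (a := a) m p
  obtain ⟨x, hx⟩ := hcS ((1 - a) * z)
  refine ⟨x + if p = m + 1 then 1 else 0, ?_⟩
  rw [map_add, hx, hc]
  simp only [Finsupp.sub_apply, Finsupp.smul_apply, smul_eq_mul, Finsupp.single_apply]
  have : algebraMap R S (if p = m + 1 then 1 else 0) = if p = m + 1 then 1 else 0 := by
    split_ifs <;> simp
  rw [this]
  by_cases h : p = m
  · rw [if_pos h] at hz ⊢
    linear_combination (1 - a) * hz
  · rw [if_neg h] at hz ⊢
    linear_combination (1 - a) * hz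

/-- The sequence s = κ - a (tail sums of κ) vanishes far out, and s m differs from s (m + 1) by κ (m
+ 1) - (1 - a) κ m ∈ R. Descending induction puts every s m in R. -/
theorem exists_algebraMap_eq_of_twistedSequences {κ : ℕ →₀ S}
    (hκ : κ ∈ twistedSequences R (1 - a)) (m : ℕ) :
    ∃ x : R, algebraMap R S x = (κ - a • Finsupp.tailSum S κ) m := by
  set s := κ - a • Finsupp.tailSum S κ
  obtain ⟨M, hM⟩ : ∃ M, ∀ m, M ≤ m → s m = 0 := by
    refine ⟨s.support.sup id + 1, fun m hm => ?_⟩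
    by_contra h
    have := Finset.le_sup (f := id) (Finsupp.mem_support_iff.mpr h)
    simp only [id] at this
    omega
  have hstep : ∀ m, s m = s (m + 1) - (κ (m + 1) - (1 - a) * κ m) := by
    intro m
    have h := Finsupp.tailSum_apply κ m
    simp only [s, Finsupp.sub_apply, Finsupp.smul_apply, smul_eq_mul]
    linear_combination (-a) * h
  have : ∀ n m, M ≤ m + n → ∃ x : R, algebraMap R S x = s m := by
    intro n
    induction n with
    | zero => exact fun m hm => ⟨0, by rw [hM m hm, map_zero]⟩
    | succ n ih =>
      intro m hm
      obtain ⟨x, hx⟩ := ih (m + 1) (by omega)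
      obtain ⟨y, hy⟩ := hκ m
      exact ⟨x - y, by rw [map_sub, hx, hy, ← hstep]⟩
  exact this M m (by omega)

/-- An almost idempotent element of `S` is the corner of an idempotent endomorphism of
`R^(ℕ) ⊕ S`. -/
theorem exists_idempotent_end_finsupp_prod {c : R} (hc : algebraMap R S c = a ^ 2 - a)
    (hcS : ∀ y : S, ∃ x : R, algebraMap R S x = algebraMap R S c * y)
    (hf : Function.Injective (algebraMap R S)) :
    ∃ E : Module.End R ((ℕ →₀ R) × S), IsIdempotentElem E ∧ (E (0, 1)).2 = a := by
  -- N is exhibited as a summand of three copies of R^(ℕ) plus S. The S-component goes in by y ↦ (a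
  -- y, 0, 0, …) and out by the total sum, so its corner is multiplication by a.
  set N := twistedSequences R (1 - a)
  let w : ℕ → (ℕ →₀ S) := fun p => ∑ q ∈ Finset.range (p + 1), Finsupp.stepVec a q
  -- The basis vector at p need not lie in N, so it is written as u p + (1 - a) w p with both
  -- vectors in N. The coefficients to be distributed are multiples of c, so they remain in R after
  -- multiplication by 1 - a.
  let u : ℕ → (ℕ →₀ S) := fun p => Finsupp.single p 1 - (1 - a) • w p
  have hl : ∀ q, Finsupp.stepVec a q ∈ N := stepVec_mem_twistedSequences hc
  have hw : ∀ p, w p ∈ N := fun p => sum_mem fun q _ => hl q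
  have hu : ∀ p, u p ∈ N := single_sub_mem_twistedSequences hc hcS
  let tail : N →ₗ[R] (ℕ →₀ S) := (Finsupp.tailSum S).restrictScalars R ∘ₗ N.subtype
  let g₁ : N →ₗ[R] (ℕ →₀ S) := N.subtype - a • tail
  let g₂ : N →ₗ[R] (ℕ →₀ S) := -((a ^ 2 - a) • tail)
  let g₃ : N →ₗ[R] (ℕ →₀ S) := (1 - a) • g₂
  obtain ⟨g₁', h₁⟩ := LinearMap.exists_lift_finsupp hf g₁ fun (κ : N) m =>
    exists_algebraMap_eq_of_twistedSequences κ.2 m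
  have hg₂ : ∀ κ m, g₂ κ m = -(algebraMap R S c * tail κ m) := by
    intro κ m; rw [hc]; rfl
  obtain ⟨g₂', h₂⟩ := LinearMap.exists_lift_finsupp hf g₂ fun (κ : N) m => by
    obtain ⟨x, hx⟩ := hcS (tail κ m)
    exact ⟨-x, by rw [map_neg, hx]; exact (hg₂ κ m).symm⟩
  obtain ⟨g₃', h₃⟩ := LinearMap.exists_lift_finsupp hf g₃ fun (κ : N) m => by
    obtain ⟨x, hx⟩ := hcS ((1 - a) * tail κ m)
    refine ⟨-x, ?_⟩
    change _ = (1 - a) * g₂ κ m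
    rw [map_neg, hx, hg₂]; ring
  let A := ℕ →₀ R
  let σ : N →ₗ[R] (A × A × A) × S :=
    (g₁'.prod (g₂'.prod g₃')).prod (Finsupp.lapply 0 ∘ₗ tail)
  let lc : (ℕ → (ℕ →₀ S)) → (A →ₗ[R] (ℕ →₀ S)) := Finsupp.linearCombination R
  let π₀ : (A × A × A) × S →ₗ[R] (ℕ →₀ S) :=
    ((lc (Finsupp.stepVec a)).coprod
      ((lc fun m => u (m + 1)).coprod (lc fun m => w (m + 1)))).coprod
    (Finsupp.lsingle 0 ∘ₗ LinearMap.mulLeft R a)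
  have hlc : ∀ v : ℕ → (ℕ →₀ S), (∀ m, v m ∈ N) → ∀ x, lc v x ∈ N := by
    intro v hv x
    simp only [lc]
    exact sum_mem fun m _ => N.smul_mem _ (hv m)
  have hπ₀ : ∀ x, π₀ x ∈ N := by
    rintro ⟨⟨x₁, x₂, x₃⟩, y⟩
    simp only [π₀, LinearMap.coprod_apply, LinearMap.comp_apply]
    exact add_mem (add_mem (hlc _ hl _) (add_mem (hlc _ (fun m => hu _) _)
      (hlc _ (fun m => hw _) _))) (single_mem_twistedSequences hc hcS y)
  let π : (A × A × A) × S →ₗ[R] N := π₀.codRestrict N hπ₀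
  have huw : ∀ t : ℕ →₀ S, Finsupp.linearCombination S (fun m => u (m + 1)) t +
      Finsupp.linearCombination S (fun m => w (m + 1)) ((1 - a) • t) =
      Finsupp.linearCombination S (fun m : ℕ => Finsupp.single (m + 1) (1 : S)) t := by
    intro t
    induction t using Finsupp.induction_linear with
    | zero => simp
    | add f g hf hg => rw [smul_add, map_add, map_add, map_add, ← hf, ← hg]; abel
    | single j y =>
      rw [map_smul, Finsupp.linearCombination_single, Finsupp.linearCombination_single,
        Finsupp.linearCombination_single, smul_comm, ← smul_add]
      simp only [u, sub_add_cancel]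
  have hπσ : ∀ κ, π (σ κ) = κ := by
    intro κ
    apply Subtype.ext
    change lc (Finsupp.stepVec a) (g₁' κ) + (lc (fun m => u (m + 1)) (g₂' κ) +
      lc (fun m => w (m + 1)) (g₃' κ)) + Finsupp.single 0 (a * Finsupp.tailSum S (κ : ℕ →₀ S) 0) =
        (κ : ℕ →₀ S)
    simp only [lc]
    rw [← Finsupp.linearCombination_mapRange_algebraMap (R := R) (S := S), h₁,
      ← Finsupp.linearCombination_mapRange_algebraMap (R := R) (S := S), h₂,
      ← Finsupp.linearCombination_mapRange_algebraMap (R := R) (S := S), h₃]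
    have := Finsupp.eq_single_sub_stepVec a (κ : ℕ →₀ S)
    rw [← huw] at this
    refine Eq.trans ?_ this.symm
    change _ = Finsupp.single 0 (a * Finsupp.tailSum S (κ : ℕ →₀ S) 0) +
      Finsupp.linearCombination S (Finsupp.stepVec a) (g₁ κ) +
      (Finsupp.linearCombination S (fun m => u (m + 1)) (g₂ κ) +
      Finsupp.linearCombination S (fun m => w (m + 1)) (g₃ κ))
    abel
  let e : ℕ ⊕ (ℕ ⊕ ℕ) ≃ ℕ := Denumerable.eqv _
  let Θ₀ : (A × A × A) ≃ₗ[R] (ℕ →₀ R) :=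
    ((LinearEquiv.refl R A).prodCongr (Finsupp.sumFinsuppLEquivProdFinsupp R).symm).trans
      ((Finsupp.sumFinsuppLEquivProdFinsupp R).symm.trans (Finsupp.domLCongr e))
  let Θ : ((A × A × A) × S) ≃ₗ[R] (ℕ →₀ R) × S := Θ₀.prodCongr (LinearEquiv.refl R S)
  refine ⟨Θ.toLinearMap ∘ₗ σ ∘ₗ π ∘ₗ Θ.symm.toLinearMap, ?_, ?_⟩
  · refine LinearMap.ext fun y => ?_
    change Θ (σ (π (Θ.symm (Θ (σ (π (Θ.symm y))))))) = Θ (σ (π (Θ.symm y)))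
    rw [LinearEquiv.symm_apply_apply, hπσ]
  · have h1 : Θ.symm (0, 1) = (0, 1) := by
      rw [LinearEquiv.symm_apply_eq]
      exact Prod.ext (map_zero Θ₀).symm rfl
    change (Θ (σ (π (Θ.symm (0, 1))))).2 = a
    rw [h1]
    have h2 : (π (0, 1) : ℕ →₀ S) = Finsupp.single 0 a := by
      change π₀ (0, 1) = _
      simp [π₀]
    change Finsupp.tailSum S (π (0, 1) : ℕ →₀ S) 0 = a
    rw [h2, Finsupp.tailSum_single, if_pos le_rfl]

end Twisted

/-! ### Determinants of the pencil of an idempotent matrix -/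

section Pencil

open Polynomial

variable {S k n m : Type*} [CommRing S] [CommRing k] [Fintype n] [DecidableEq n] [Fintype m]
  [DecidableEq m]

/-- The matrix pencil `(1 - M) + X M`. -/
noncomputable def Matrix.pencil (M : Matrix n n S) : Matrix n n S[X] :=
  (1 - M).map C + (X : S[X]) • M.map C

theorem Matrix.map_det_pencil (f : S →+* k) (M : Matrix n n S) :
    M.pencil.det.map f = (M.map f).pencil.det := by
  rw [← Polynomial.coe_mapRingHom, RingHom.map_det]
  congr 1
  ext i j : 1
  by_cases h : i = j
  · subst h
    simp [Matrix.pencil]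
  · simp [Matrix.pencil, Matrix.one_apply_ne h]

theorem Matrix.det_pencil_fromBlocks (A : Matrix n n S) (B : Matrix m n S) (D : Matrix m m S) :
    (Matrix.fromBlocks A 0 B D).pencil.det = A.pencil.det * D.pencil.det := by
  rw [← Matrix.det_fromBlocks_zero₁₂ _ ((-B).map C + (X : S[X]) • B.map C)]
  congr 1
  ext (i | i) (j | j) : 2 <;> simp [Matrix.pencil, Matrix.one_apply]

/-- The pencils of M and 1 - M multiply to the scalar X, so the determinant is a constant unit times
a power of X. At X = 1 the pencil is the identity, so the constant is 1. -/
theorem Matrix.det_pencil_of_isIdempotentElem [IsDomain S] {M : Matrix n n S}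
    (hM : IsIdempotentElem M) : ∃ ρ : ℕ, M.pencil.det = X ^ ρ := by
  have hM' : M.map (C : S →+* S[X]) * M.map C = M.map C := by
    rw [← Matrix.map_mul, hM.eq]
  have h1 : (1 - M).map (C : S →+* S[X]) = 1 - M.map C := by
    rw [Matrix.map_sub _ (by simp), Matrix.map_one _ (by simp) (by simp)]
  have h2 : M.pencil * (1 - M).pencil = (X : S[X]) • (1 : Matrix n n S[X]) := by
    unfold Matrix.pencil
    rw [sub_sub_cancel, h1]
    set Z := M.map (C : S →+* S[X])
    have ha : (1 - Z) * Z = 0 := by rw [sub_mul, one_mul, hM', sub_self]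
    have hb : Z * (1 - Z) = 0 := by rw [mul_sub, mul_one, hM', sub_self]
    have hd : (1 - Z) * (1 - Z) = 1 - Z := by rw [sub_mul, one_mul, hb, sub_zero]
    rw [add_mul, mul_add, mul_add, ha, mul_smul_comm, hd, smul_mul_assoc, hM', smul_mul_smul_comm,
      hb, smul_zero, add_zero, zero_add, ← smul_add, sub_add_cancel]
  have h3 : M.pencil.det ∣ X ^ Fintype.card n := by
    refine ⟨(1 - M).pencil.det, ?_⟩
    rw [← Matrix.det_mul, h2, Matrix.det_smul, Matrix.det_one, mul_one]
  obtain ⟨ρ, -, hρ⟩ := (dvd_prime_pow Polynomial.prime_X _).mp h3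
  obtain ⟨u, hu⟩ := hρ.symm
  obtain ⟨s, -, hs⟩ := Polynomial.isUnit_iff.mp u.isUnit
  have h4 : M.pencil.det.eval 1 = 1 := by
    rw [← Polynomial.coe_evalRingHom, RingHom.map_det]
    refine (congrArg Matrix.det ?_).trans Matrix.det_one
    ext i j : 1
    by_cases h : i = j
    · subst h
      simp [Matrix.pencil]
    · simp [Matrix.pencil, Matrix.one_apply_ne h]
  rw [← hu, ← hs, eval_mul, eval_pow, eval_X, one_pow, one_mul, eval_C] at h4
  exact ⟨ρ, by rw [← hu, ← hs, h4, C_1, mul_one]⟩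

/-- On R the map ψ factors through the residue field, and the vanishing of v makes the image block
triangular. The A-factor comes from one polynomial over the residue field, independent of ψ, which
allows two places to be compared. -/
theorem exists_map_det_pencil_mul_eq {R F : Type*} [CommRing R] [IsLocalRing R] [Algebra R S]
    [Fintype F] [DecidableEq F]
    {A : Matrix F F R} {v : Matrix F Unit S} {w : Matrix Unit F S} {α : S} {p : S[X]}
    (hM : (Matrix.fromBlocks (A.map (algebraMap R S)) v w (Matrix.of fun _ _ => α)).pencil.det = p)
    {k : Type*} [Field k] (ψ : S →+* k) (hψ : ∀ r, ¬ IsUnit r → ψ (algebraMap R S r) = 0)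
    (hv : v.map ψ = 0) : ∃ f : IsLocalRing.ResidueField R →+* k,
      (A.map (IsLocalRing.residue R)).pencil.det.map f * (1 - C (ψ α) + X * C (ψ α)) =
        p.map ψ := by
  let f : IsLocalRing.ResidueField R →+* k :=
    Ideal.Quotient.lift (IsLocalRing.maximalIdeal R) (ψ.comp (algebraMap R S)) hψ
  refine ⟨f, ?_⟩
  have hA : (A.map (IsLocalRing.residue R)).map f = (A.map (algebraMap R S)).map ψ := by
    ext i j
    rfl
  rw [← hM, Matrix.map_det_pencil, Matrix.map_det_pencil, Matrix.fromBlocks_map, hv,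
    Matrix.det_pencil_fromBlocks, hA, Matrix.det_unique (Matrix.pencil (n := Unit) _)]
  simp [Matrix.pencil]

end Pencil

/-! ### Corners of endomorphisms of R^(ω) ⊕ S at two places -/

section Conductor

open Polynomial

variable {R S : Type*} [CommRing R] [CommRing S] [IsDomain S] [Algebra R S]
  {c : R}

/-- An `R`-linear functional on `S` takes values in the conductor. -/
theorem LinearMap.algebraMap_apply_eq_mul (hc : algebraMap R S c ≠ 0)
    (hcS : ∀ y : S, ∃ x : R, algebraMap R S x = algebraMap R S c * y) (f : S →ₗ[R] S) (s : S) :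
    f s = s * f 1 := by
  obtain ⟨x, hx⟩ := hcS s
  apply mul_left_cancel₀ hc
  rw [← Algebra.smul_def, ← map_smul, Algebra.smul_def, ← hx, ← mul_one (algebraMap R S x),
    ← Algebra.smul_def, map_smul, Algebra.smul_def, hx, mul_assoc]

theorem algebraMap_linearMap_apply (hc : algebraMap R S c ≠ 0)
    (hcS : ∀ y : S, ∃ x : R, algebraMap R S x = algebraMap R S c * y) (f : S →ₗ[R] R) (s : S) :
    algebraMap R S (f s) = s * algebraMap R S (f 1) :=
  LinearMap.algebraMap_apply_eq_mul hc hcS (Algebra.linearMap R S ∘ₗ f) s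

/-- The functional is multiplication by f 1. If f 1 were a unit of R, every element of S would come
from R; so f 1 is a nonunit and ψ kills it. -/
theorem map_linearMap_apply_eq_zero (hc : algebraMap R S c ≠ 0)
    (hcS : ∀ y : S, ∃ x : R, algebraMap R S x = algebraMap R S c * y)
    (hS : ¬ Function.Surjective (algebraMap R S)) {k : Type*} [Field k] (ψ : S →+* k)
    (hψ : ∀ r, ¬ IsUnit r → ψ (algebraMap R S r) = 0) (f : S →ₗ[R] R) (s : S) :
    ψ (algebraMap R S (f s)) = 0 := by
  rw [algebraMap_linearMap_apply hc hcS, map_mul, hψ _ fun hu => hS fun y => ?_, mul_zero]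
  obtain ⟨r, hr⟩ := isUnit_iff_exists_inv.mp hu
  refine ⟨f y * r, ?_⟩
  rw [map_mul, algebraMap_linearMap_apply hc hcS, mul_assoc, ← map_mul, hr, map_one, mul_one]

/-- The contribution to the corner of f g that passes through R^(ℕ) has coefficients given by
functionals S → R, which ψ kills. -/
theorem corner_mul (hc : algebraMap R S c ≠ 0)
    (hcS : ∀ y : S, ∃ x : R, algebraMap R S x = algebraMap R S c * y)
    (hS : ¬ Function.Surjective (algebraMap R S)) {k : Type*} [Field k] (ψ : S →+* k)
    (hψ : ∀ r, ¬ IsUnit r → ψ (algebraMap R S r) = 0) (f g : Module.End R ((ℕ →₀ R) × S)) :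
    ψ ((f * g) (0, 1)).2 = ψ (f (0, 1)).2 * ψ (g (0, 1)).2 := by
  have h1 : (g (0, 1)) = ((g (0, 1)).1, 0) + (0, (g (0, 1)).2) := by simp
  rw [Module.End.mul_apply, h1, map_add, Prod.snd_add, map_add]
  have h2 : (f (0, (g (0, 1)).2)).2 = (g (0, 1)).2 * (f (0, 1)).2 :=
    LinearMap.algebraMap_apply_eq_mul hc hcS
      (LinearMap.snd R _ _ ∘ₗ f ∘ₗ LinearMap.inr R (ℕ →₀ R) S) (g (0, 1)).2
  have h3 : ψ (f ((g (0, 1)).1, 0)).2 = 0 := by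
    have hx : ∀ j, ψ (algebraMap R S ((g (0, 1)).1 j)) = 0 := fun j =>
      map_linearMap_apply_eq_zero hc hcS hS ψ hψ
        (Finsupp.lapply j ∘ₗ LinearMap.fst R _ _ ∘ₗ g ∘ₗ LinearMap.inr R (ℕ →₀ R) S) 1
    generalize (g (0, 1)).1 = x at hx
    let F : (ℕ →₀ R) →ₗ[R] S := LinearMap.snd R _ _ ∘ₗ f ∘ₗ LinearMap.inl R (ℕ →₀ R) S
    change ψ (F x) = 0
    rw [← Finsupp.sum_single x, Finsupp.sum, map_sum, map_sum]
    refine Finset.sum_eq_zero fun j _ => ?_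
    rw [← mul_one (x j), ← smul_eq_mul, ← Finsupp.smul_single, map_smul, Algebra.smul_def,
      map_mul, hx, zero_mul]
  rw [h3, zero_add, h2, map_mul, mul_comm, Prod.snd_add, zero_add]

/-- With finitely generated range, e is captured by a finite idempotent matrix M with pencil
determinant X ^ ρ. Corner 0 at ψ₀ forces the R-block to contribute X ^ ρ, while corner 1 at ψ₁ would
add a further factor X. -/
theorem not_map_corner_eq_of_finite_range [IsLocalRing R] (hc : algebraMap R S c ≠ 0)
    (hcS : ∀ y : S, ∃ x : R, algebraMap R S x = algebraMap R S c * y)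
    (hS : ¬ Function.Surjective (algebraMap R S)) {k₀ k₁ : Type*} [Field k₀] [Field k₁]
    (ψ₀ : S →+* k₀) (ψ₁ : S →+* k₁) (hψ₀ : ∀ r, ¬ IsUnit r → ψ₀ (algebraMap R S r) = 0)
    (hψ₁ : ∀ r, ¬ IsUnit r → ψ₁ (algebraMap R S r) = 0)
    {e : Module.End R ((ℕ →₀ R) × S)} (he : IsIdempotentElem e)
    (hfin : (LinearMap.range e).FG) (h₀ : ψ₀ (e (0, 1)).2 = 0) : ψ₁ (e (0, 1)).2 ≠ 1 := by
  classical
  intro h₁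
  obtain ⟨F, hF⟩ : ∃ F : Finset ℕ, ∀ y, (e y).1.support ⊆ F := by
    obtain ⟨T, hT⟩ := hfin
    refine ⟨T.biUnion fun y => y.1.support, fun y => ?_⟩
    have : LinearMap.range e ≤ (Finsupp.supported R R
        ((T.biUnion fun y => y.1.support : Finset ℕ) : Set ℕ)).comap (LinearMap.fst R _ S) := by
      rw [← hT, Submodule.span_le]
      intro y hy
      change y.1 ∈ Finsupp.supported R R _
      rw [Finsupp.mem_supported]
      exact_mod_cast Finset.subset_biUnion_of_mem (fun y : (ℕ →₀ R) × S => y.1.support) hy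
    have h := this (LinearMap.mem_range_self e y)
    exact_mod_cast (Finsupp.mem_supported R _).mp h
  let b : F ⊕ Unit → (ℕ →₀ R) × S := Sum.elim (fun j => (Finsupp.single j 1, 0)) fun _ => (0, 1)
  let Φ : ((ℕ →₀ R) × S) →ₗ[R] (F ⊕ Unit → S) := LinearMap.pi
    (Sum.elim (fun j => Algebra.linearMap R S ∘ₗ Finsupp.lapply (j : ℕ) ∘ₗ LinearMap.fst R _ _)
      fun _ => LinearMap.snd R _ _)
  let M : Matrix (F ⊕ Unit) (F ⊕ Unit) S := Matrix.of fun i j => Φ (e (b j)) i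
  have hΦ : ∀ y : (ℕ →₀ R) × S, y.1.support ⊆ F → Φ (e y) = M.mulVec (Φ y) := by
    intro y hy
    obtain ⟨x, hx⟩ := hcS y.2
    -- The second coordinate of y lies in S only; after multiplication by c it becomes an R-multiple
    -- of (0, 1).
    have hcy : c • y = ∑ j, (Sum.elim (fun j : F => c * y.1 j) (fun _ => x) j : R) • b j := by
      rw [Fintype.sum_sum_type]
      simp only [Sum.elim_inl, Sum.elim_inr, Finset.univ_unique, Finset.sum_const,
        Finset.card_singleton, one_smul, b]
      refine Prod.ext ?_ ?_
      · rw [Prod.fst_add, Prod.fst_sum, Prod.smul_fst, Prod.smul_fst, smul_zero, add_zero]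
        conv_lhs => rw [← Finsupp.sum_single y.1, Finsupp.sum_of_support_subset _ hy _ (by simp)]
        rw [Finset.smul_sum, ← Finset.sum_coe_sort]
        refine Finset.sum_congr rfl fun j _ => ?_
        simp
      · rw [Prod.snd_add, Prod.snd_sum, Prod.smul_snd, Prod.smul_snd, Algebra.smul_def,
          Algebra.smul_def, hx]
        simp
    have h := congrArg (fun y => Φ (e y)) hcy
    simp only [map_smul, map_sum] at h
    ext i
    have hi := congrFun h i
    rw [Pi.smul_apply, Algebra.smul_def, Finset.sum_apply] at hi
    apply mul_left_cancel₀ hc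
    rw [hi, Matrix.mulVec, dotProduct, Finset.mul_sum]
    refine Finset.sum_congr rfl fun j _ => ?_
    rw [Pi.smul_apply, Algebra.smul_def]
    rcases j with j | j
    · simp only [Sum.elim_inl, map_mul, M, Matrix.of_apply, Φ, LinearMap.pi_apply,
        LinearMap.comp_apply, LinearMap.fst_apply, Finsupp.lapply_apply, Algebra.linearMap_apply]
      ring
    · simp only [Sum.elim_inr, hx, M, Matrix.of_apply, Φ, LinearMap.pi_apply, LinearMap.snd_apply]
      ring
  have hM : IsIdempotentElem M := by
    ext i j
    have h := congrFun (hΦ (e (b j)) (hF _)) i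
    rw [← Module.End.mul_apply, he.eq] at h
    exact h.symm
  obtain ⟨ρ, hρ⟩ := Matrix.det_pencil_of_isIdempotentElem hM
  let A : Matrix F F R := Matrix.of fun i j => (e (Finsupp.single j 1, 0)).1 i
  let v : Matrix F Unit S := Matrix.of fun i _ => algebraMap R S ((e (0, 1)).1 i)
  let w : Matrix Unit F S := Matrix.of fun _ j => (e (Finsupp.single j 1, 0)).2
  have hMb : M = Matrix.fromBlocks (A.map (algebraMap R S)) v w
      (Matrix.of fun _ _ => (e (0, 1)).2) := by
    ext (i | i) (j | j) <;> rfl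
  rw [hMb] at hρ
  obtain ⟨f₀, hf₀⟩ := exists_map_det_pencil_mul_eq hρ ψ₀ hψ₀ (by
    ext i j
    exact map_linearMap_apply_eq_zero hc hcS hS ψ₀ hψ₀
      (Finsupp.lapply (i : ℕ) ∘ₗ LinearMap.fst R _ _ ∘ₗ e ∘ₗ LinearMap.inr R (ℕ →₀ R) S) 1)
  obtain ⟨f₁, hf₁⟩ := exists_map_det_pencil_mul_eq hρ ψ₁ hψ₁ (by
    ext i j
    exact map_linearMap_apply_eq_zero hc hcS hS ψ₁ hψ₁
      (Finsupp.lapply (i : ℕ) ∘ₗ LinearMap.fst R _ _ ∘ₗ e ∘ₗ LinearMap.inr R (ℕ →₀ R) S) 1)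
  rw [h₀, C_0, mul_zero, sub_zero, add_zero, mul_one] at hf₀
  have hG : (A.map (IsLocalRing.residue R)).pencil.det = X ^ ρ := by
    apply Polynomial.map_injective f₀ f₀.injective
    rw [hf₀, Polynomial.map_pow, Polynomial.map_pow, Polynomial.map_X, Polynomial.map_X]
  rw [hG, h₁, C_1, mul_one, sub_self, zero_add, Polynomial.map_pow, Polynomial.map_X,
    Polynomial.map_pow, Polynomial.map_X, ← pow_succ] at hf₁
  have := congrArg natDegree hf₁
  rw [natDegree_X_pow, natDegree_X_pow] at this
  omega

/-- Each piece of a decomposition gives an idempotent e i with e i * E = e i, so its corner vanishes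
at ψ₀. By multiplicativity its corner at ψ₁ is 0 or 1, and 1 is excluded; yet finitely many of these
corners sum to that of E, which is 1 at ψ₁. -/
theorem not_isDirectSumFG_range {R : Type u} {S : Type u} [CommRing R] [IsLocalRing R]
    [CommRing S] [IsDomain S] [Algebra R S] {c : R} (hc : algebraMap R S c ≠ 0)
    (hcS : ∀ y : S, ∃ x : R, algebraMap R S x = algebraMap R S c * y)
    {k₀ k₁ : Type*} [Field k₀] [Field k₁]
    (ψ₀ : S →+* k₀) (ψ₁ : S →+* k₁) (hψ₀ : ∀ r, ¬ IsUnit r → ψ₀ (algebraMap R S r) = 0)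
    (hψ₁ : ∀ r, ¬ IsUnit r → ψ₁ (algebraMap R S r) = 0)
    {E : Module.End R ((ℕ →₀ R) × S)} (hE : IsIdempotentElem E) (h₀ : ψ₀ (E (0, 1)).2 = 0)
    (h₁ : ψ₁ (E (0, 1)).2 = 1) : ¬ IsDirectSumFG R (LinearMap.range E) := by
  have hS : ¬ Function.Surjective (algebraMap R S) := by
    intro h
    obtain ⟨r, hr⟩ := h (E (0, 1)).2
    by_cases hu : IsUnit r
    · have := (hu.map (algebraMap R S)).map ψ₀
      rw [hr, h₀] at this
      exact not_isUnit_zero this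
    · have := hψ₁ r hu
      rw [hr, h₁] at this
      exact one_ne_zero this
  intro h
  obtain ⟨ι, N, hN, htop, hfg⟩ := isDirectSumOf_iff_decomposesInto.mp h
  obtain ⟨p, hp, hpN, -, hsum⟩ :=
    iSupIndep.exists_projections (R := R) (X := LinearMap.range E) hN htop
  let e : ι → Module.End R ((ℕ →₀ R) × S) := fun i =>
    (LinearMap.range E).subtype ∘ₗ p i ∘ₗ E.rangeRestrict
  have heE : ∀ i, e i * E = e i := fun i => LinearMap.ext fun y => by
    have : E.rangeRestrict (E y) = E.rangeRestrict y :=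
      Subtype.ext (congrArg (fun f : Module.End R _ => f y) hE.eq)
    change ((p i (E.rangeRestrict (E y)) : LinearMap.range E) : (ℕ →₀ R) × S) =
      (p i (E.rangeRestrict y) : LinearMap.range E)
    rw [this]
  have hee : ∀ i, IsIdempotentElem (e i) := fun i => LinearMap.ext fun y => by
    have : ∀ z : LinearMap.range E, E.rangeRestrict z = z := by
      rintro ⟨_, z, rfl⟩
      exact Subtype.ext (congrArg (fun f : Module.End R _ => f z) hE.eq)
    change ((p i (E.rangeRestrict (p i (E.rangeRestrict y) : LinearMap.range E)) :
      LinearMap.range E) : (ℕ →₀ R) × S) = (p i (E.rangeRestrict y) : LinearMap.range E)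
    rw [this, hpN i _ (hp i _)]
  have hefg : ∀ i, (LinearMap.range (e i)).FG := fun i => by
    have : LinearMap.range (e i) = (N i).map (LinearMap.range E).subtype := by
      apply le_antisymm
      · rintro _ ⟨y, rfl⟩
        exact ⟨_, hp i _, rfl⟩
      · rintro _ ⟨z, hz, rfl⟩
        obtain ⟨y, hy⟩ := E.surjective_rangeRestrict z
        refine ⟨y, ?_⟩
        change ((p i (E.rangeRestrict y) : LinearMap.range E) : (ℕ →₀ R) × S) = _
        rw [hy, hpN i z hz]
        rfl
    rw [this]
    exact (Module.Finite.iff_fg.mp (hfg i)).map _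
  have hz : ∀ i, ψ₀ (e i (0, 1)).2 = 0 := fun i => by
    rw [← heE, corner_mul hc hcS hS ψ₀ hψ₀, h₀, mul_zero]
  obtain ⟨F, hF⟩ := Submodule.mem_iSup_iff_exists_finset.mp
    (show E.rangeRestrict (0, 1) ∈ ⨆ i, N i by rw [htop]; trivial)
  have hE1 : ∑ i ∈ F, (e i (0, 1)).2 = (E (0, 1)).2 := by
    have := congrArg (fun z : LinearMap.range E => (z : (ℕ →₀ R) × S).2) (hsum F _ hF)
    simp only [AddSubmonoidClass.coe_finsetSum, Prod.snd_sum] at this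
    exact this
  have : ∀ i, ψ₁ (e i (0, 1)).2 = 0 := fun i => by
    by_contra hne
    refine not_map_corner_eq_of_finite_range hc hcS hS ψ₀ ψ₁ hψ₀ hψ₁ (hee i) (hefg i) (hz i) ?_
    have h := corner_mul hc hcS hS ψ₁ hψ₁ (e i) (e i)
    rw [(hee i).eq] at h
    exact (mul_left_cancel₀ hne (by rw [mul_one, ← h])).symm
  rw [← hE1, map_sum, Finset.sum_eq_zero fun i _ => this i] at h₁
  exact zero_ne_one h₁

end Conductor

/-! ### The implications between the conditions -/

section Implications

variable {R : Type u} [CommRing R]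

theorem isExchangeRing_end_of_valuationRing [IsDomain R] [IsLocalRing R] [Ring.DimensionLEOne R]
    (hR : ¬ IsField R) {Q : Type*} [Field Q] [Algebra R Q] [IsFractionRing R Q]
    (hV : ValuationRing (integralClosure R Q)) (M : Type*) [AddCommGroup M] [Module R M]
    [Module.Finite R M] [Module.IsTorsionFree R M] : IsExchangeRing (Module.End R M) := by
  have : IsFractionRing (integralClosure R Q) Q :=
    integralClosure.isFractionRing_of_finite_extension Q Q
  refine isExchangeRing_end hR (integralClosure R Q) (fun x => ?_) (fun x hx => hx) M
  rcases ValuationRing.isInteger_or_isInteger (integralClosure R Q) x with ⟨y, hy⟩ | ⟨y, hy⟩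
  · exact .inl (hy ▸ y.2)
  · exact .inr (hy ▸ y.2)

theorem isDirectSumLocalEnd_of_exchange [IsDomain R] (M : Type v) [AddCommGroup M]
    [Module R M] [Module.Finite R M] [Module.IsTorsionFree R M]
    (hex : ∀ B : Submodule R M, Module.Finite R B → IsExchangeRing (Module.End R B)) :
    IsDirectSumLocalEnd R M := by
  refine isDirectSumOf_iff_decomposesInto.mpr ?_
  exact (Submodule.decomposesInto_localEnd hex ⊤ (Module.Finite.equiv Submodule.topEquiv.symm)).mono
    fun _ _ h => h.2

theorem IsIndecomposableModule.isLocalRing_end {M : Type v} [AddCommGroup M] [Module R M]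
    (hM : IsIndecomposableModule R M) (hex : IsExchangeRing (Module.End R M)) :
    IsLocalRing (Module.End R M) := by
  have := hM.1
  refine hex.isLocalRing fun e he => ?_
  rcases hM.2 _ _ (LinearMap.IsIdempotentElem.isCompl he) with h | h
  · exact .inl (LinearMap.range_eq_bot.mp h)
  · rw [LinearMap.IsIdempotentElem.ker_eq_range_one_sub he, LinearMap.range_eq_bot,
      sub_eq_zero] at h
    exact .inr h.symm

theorem isIndecomposableModule_of_finrank_eq_one [IsDomain R] (M : Type v) [AddCommGroup M]
    [Module R M] [Module.Finite R M] [Module.IsTorsionFree R M] (h : Module.finrank R M = 1) :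
    IsIndecomposableModule R M := by
  refine ⟨Module.nontrivial_of_finrank_pos (R := R) (by omega), fun A B hAB => ?_⟩
  have hA : Module.Finite R A := Module.Finite.equiv (B.quotientEquivOfIsCompl A hAB.symm)
  have hB : Module.Finite R B := Module.Finite.equiv (A.quotientEquivOfIsCompl B hAB)
  by_contra! hne
  have := Submodule.nontrivial_iff_ne_bot.mpr hne.1
  have := Submodule.nontrivial_iff_ne_bot.mpr hne.2
  have h1 : 0 < Module.finrank R A := Module.finrank_pos
  have h2 : 0 < Module.finrank R B := Module.finrank_pos
  have hsum := Submodule.finrank_quotient_add_finrank A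
  rw [(A.quotientEquivOfIsCompl B hAB).finrank_eq] at hsum
  omega

theorem IsDirectSumFGTorsionFree.of_isComplemented [IsDomain R] {M : Type v} [AddCommGroup M]
    [Module R M] (hM : IsDirectSumFGTorsionFree R M)
    (hex : ∀ (B : Type v) [AddCommGroup B] [Module R B] [Module.Finite R B]
      [Module.IsTorsionFree R B], IsExchangeRing (Module.End R B))
    (N : Submodule R M) (hN : IsComplemented N) : IsDirectSumFGTorsionFree R N := by
  obtain ⟨ι, L, hL, htop, hP⟩ := isDirectSumOf_iff_decomposesInto.mp hM
  have htf : Module.IsTorsionFree R M := hL.isTorsionFree htop fun i => (hP i).2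
  refine (Submodule.decomposesInto_fg_of_isComplemented hL htop (fun i => (hP i).1)
    (fun B _ => hex B) N hN).isDirectSumOf fun B hB hBfin => ⟨?_, inferInstance⟩
  exact Module.Finite.equiv (Submodule.comapSubtypeEquivOfLe hB).symm

theorem IsDirectSumFGTorsionFreeRankOne.of_isComplemented [IsDomain R] {M : Type v}
    [AddCommGroup M] [Module R M] (hM : IsDirectSumFGTorsionFreeRankOne R M)
    (hex : ∀ (B : Type v) [AddCommGroup B] [Module R B] [Module.Finite R B]
      [Module.IsTorsionFree R B], IsExchangeRing (Module.End R B))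
    (N : Submodule R M) (hN : IsComplemented N) : IsDirectSumFGTorsionFreeRankOne R N := by
  obtain ⟨ι, L, hL, htop, hP⟩ := isDirectSumOf_iff_decomposesInto.mp hM
  have htf : Module.IsTorsionFree R M := hL.isTorsionFree htop fun i => (hP i).2.1
  refine (Submodule.decomposesInto_rankOne_of_isComplemented hL htop (fun i => (hP i).1) htf
    (fun i => (hP i).2.2) (fun B _ => hex B) N hN).isDirectSumOf
    fun B hB hBP => ⟨?_, inferInstance, ?_⟩
  · have := hBP.1
    exact Module.Finite.equiv (Submodule.comapSubtypeEquivOfLe hB).symm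
  · rw [(Submodule.comapSubtypeEquivOfLe hB).finrank_eq, hBP.2]

theorem IsDirectSumOf.mono {M : Type v} [AddCommGroup M] [Module R M]
    {P P' : Submodule R M → Prop} (h : IsDirectSumOf R M P) (hP : ∀ N, P N → P' N) :
    IsDirectSumOf R M P' := by
  obtain ⟨ι, hι, N, hN, hPN⟩ := h
  exact ⟨ι, hι, N, hN, fun i => hP _ (hPN i)⟩

/-- `R^(ℕ) ⊕ M` is the direct sum of copies of `R` and of `M`. -/
theorem isDirectSumOf_finsupp_prod (M : Type u) [AddCommGroup M] [Module R M]
    {P : Submodule R ((ℕ →₀ R) × M) → Prop}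
    (hR : ∀ f : R →ₗ[R] (ℕ →₀ R) × M, Function.Injective f → P (LinearMap.range f))
    (hM : ∀ f : M →ₗ[R] (ℕ →₀ R) × M, Function.Injective f → P (LinearMap.range f)) :
    IsDirectSumOf R ((ℕ →₀ R) × M) P := by
  rw [isDirectSumOf_iff_decomposesInto]
  let Y := (ℕ →₀ R) × M
  let g : ULift.{u} (Option ℕ) → Module.End R Y := fun i => i.down.elim
    (LinearMap.inr R _ _ ∘ₗ LinearMap.snd R _ _)
    fun j => LinearMap.inl R _ _ ∘ₗ Finsupp.lsingle j ∘ₗ Finsupp.lapply j ∘ₗ LinearMap.fst R _ _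
  have hidem : ∀ i, IsIdempotentElem (g i) := by
    rintro ⟨_ | i⟩
    · exact LinearMap.ext fun y => rfl
    · refine LinearMap.ext fun y => Prod.ext ?_ rfl
      change Finsupp.single i (Finsupp.single i (y.1 i) i) = Finsupp.single i (y.1 i)
      rw [Finsupp.single_eq_same]
  have horth : ∀ i j, i ≠ j → g i * g j = 0 := by
    rintro ⟨_ | i⟩ ⟨_ | j⟩ hij
    · exact absurd rfl hij
    · exact LinearMap.ext fun y => Prod.ext rfl rfl
    · refine LinearMap.ext fun y => Prod.ext ?_ rfl
      exact Finsupp.single_zero i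
    · refine LinearMap.ext fun y => Prod.ext ?_ rfl
      change Finsupp.single i (Finsupp.single j (y.1 j) i) = 0
      rw [Finsupp.single_eq_of_ne (fun h => hij (by rw [h])), Finsupp.single_zero]
  refine ⟨_, _, iSupIndep_range_of_orthogonal hidem horth, ?_, ?_⟩
  · rw [eq_top_iff]
    rintro ⟨x, m⟩ -
    have h1 : (x, m) = LinearMap.inl R (ℕ →₀ R) M x + LinearMap.inr R (ℕ →₀ R) M m := by simp
    rw [h1]
    refine add_mem ?_ ((le_iSup (fun i => LinearMap.range (g i)) ⟨none⟩) ⟨(0, m), rfl⟩)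
    rw [← Finsupp.sum_single x, Finsupp.sum, map_sum]
    refine sum_mem fun j _ => (le_iSup (fun i => LinearMap.range (g i)) ⟨some j⟩) ⟨(x, 0), rfl⟩
  · rintro ⟨_ | j⟩
    · have : LinearMap.range (g ⟨none⟩) = LinearMap.range (LinearMap.inr R (ℕ →₀ R) M) :=
        LinearMap.range_comp_of_range_eq_top _
          (LinearMap.range_eq_top.mpr LinearMap.snd_surjective)
      rw [this]
      exact hM _ LinearMap.inr_injective
    · have : LinearMap.range (g ⟨some j⟩) =
          LinearMap.range (LinearMap.inl R (ℕ →₀ R) M ∘ₗ Finsupp.lsingle j) := by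
        refine (LinearMap.range_comp_of_range_eq_top
          (f := Finsupp.lapply j ∘ₗ LinearMap.fst R (ℕ →₀ R) M)
          (LinearMap.inl R (ℕ →₀ R) M ∘ₗ Finsupp.lsingle j) ?_)
        rw [LinearMap.range_eq_top]
        exact fun r => ⟨(Finsupp.single j r, 0), Finsupp.single_eq_same⟩
      rw [this]
      exact hR _ (LinearMap.inl_injective.comp (Finsupp.single_injective j))

theorem isDirectSumFGTorsionFree_finsupp_prod [IsDomain R] (M : Type u) [AddCommGroup M]
    [Module R M] [Module.Finite R M] [Module.IsTorsionFree R M] :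
    IsDirectSumFGTorsionFree R ((ℕ →₀ R) × M) :=
  isDirectSumOf_finsupp_prod M (fun _ _ => ⟨inferInstance, inferInstance⟩)
    fun _ _ => ⟨inferInstance, inferInstance⟩

theorem isDirectSumFGTorsionFreeRankOne_finsupp_prod [IsDomain R] (M : Type u)
    [AddCommGroup M] [Module R M] [Module.Finite R M] [Module.IsTorsionFree R M] (h : Module.finrank R M = 1) :
    IsDirectSumFGTorsionFreeRankOne R ((ℕ →₀ R) × M) :=
  isDirectSumOf_finsupp_prod M
    (fun f hf => ⟨inferInstance, inferInstance, by
      rw [← (LinearEquiv.ofInjective f hf).finrank_eq, Module.finrank_self]⟩)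
    fun f hf => ⟨inferInstance, inferInstance, by
      rw [← (LinearEquiv.ofInjective f hf).finrank_eq, h]⟩

/-- Multiplication by r embeds S into R, and R embeds into S. -/
theorem Subalgebra.finrank_eq_one_of_smul_mem [IsDomain R] {Q : Type*} [Field Q]
    [Algebra R Q] [IsFractionRing R Q] (S : Subalgebra R Q) [Module.Finite R S] {r : R} (hr : r ≠ 0)
    (hS : ∀ y ∈ S, ∃ x : R, algebraMap R Q x = r • y) : Module.finrank R S = 1 := by
  have hinj := IsFractionRing.injective R Q
  apply le_antisymm
  · choose f hf using fun y : S => hS y y.2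
    let F : S →ₗ[R] R :=
      { toFun := f
        map_add' := fun x y => hinj (by rw [map_add, hf, hf, hf, S.coe_add, smul_add])
        map_smul' := fun s x => hinj (by
          rw [hf, smul_eq_mul, map_mul, RingHom.id_apply, hf, S.coe_smul, smul_comm,
            Algebra.smul_def]) }
    have hF : Function.Injective F := by
      intro x y hxy
      have h : r • (x : Q) = r • (y : Q) := by
        rw [← hf, ← hf]
        exact congrArg _ hxy
      rw [Algebra.smul_def, Algebra.smul_def] at h
      exact Subtype.ext (mul_left_cancel₀ (fun h0 => hr (hinj (by rw [h0, map_zero]))) h)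
    exact (LinearMap.finrank_le_finrank_of_injective hF).trans (Module.finrank_self R).le
  · rw [← Module.finrank_self R]
    refine LinearMap.finrank_le_finrank_of_injective (f := Algebra.linearMap R S) fun x y hxy => ?_
    exact hinj (congrArg Subtype.val hxy)

/-- For integral α, multiplications by α and 1 - α on S = R[α] add up to the identity of a rank one
module. One of them is bijective, and its multiplier is then a unit. -/
theorem isLocalRing_integralClosure_of_isLocalRing_end [IsDomain R] [IsLocalRing R]
    (hR : ¬ IsField R) {Q : Type u} [Field Q] [Algebra R Q] [IsFractionRing R Q]
    (h : ∀ (M : Type u) [AddCommGroup M] [Module R M],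
      Module.Finite R M → Module.IsTorsionFree R M → Module.finrank R M = 1 →
      IsLocalRing (Module.End R M)) : IsLocalRing (integralClosure R Q) := by
  refine IsLocalRing.of_isUnit_or_isUnit_one_sub_self fun α => ?_
  obtain ⟨S, hSV, hα, hfin, -, r, hr, -, hrS⟩ := exists_finite_subalgebra hR
    (integralClosure R Q) (fun x hx => hx) {(α : Q)} (Set.finite_singleton _)
    (Set.singleton_subset_iff.mpr α.2)
  have : Module.IsTorsionFree R Q := inferInstance
  have := h S hfin inferInstance (S.finrank_eq_one_of_smul_mem hr hrS)
  let β : S := ⟨α, hα rfl⟩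
  have hunit : ∀ γ : S, IsUnit (LinearMap.mulLeft R γ) →
      IsUnit (Subalgebra.inclusion hSV γ) := by
    intro γ hγ
    obtain ⟨y, hy⟩ := ((Module.End.isUnit_iff _).mp hγ).2 1
    exact (IsUnit.of_mul_eq_one y hy).map _
  have h1 : LinearMap.mulLeft R β + LinearMap.mulLeft R (1 - β) = 1 :=
    LinearMap.ext fun y => by simp [sub_mul]
  rcases IsLocalRing.isUnit_or_isUnit_of_add_one h1 with h | h
  · exact .inl (hunit _ h)
  · have := hunit _ h
    rw [map_sub, map_one] at this
    exact .inr this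

theorem isLocalRing_integralClosure_of_isDirectSumFG [IsDomain R] [IsLocalRing R]
    [Ring.DimensionLEOne R] (hR : ¬ IsField R) {Q : Type u} [Field Q] [Algebra R Q] [IsFractionRing R Q]
    (h : ∀ (M : Type u) [AddCommGroup M] [Module R M],
      Module.Finite R M → Module.IsTorsionFree R M → Module.finrank R M = 1 →
      ∀ N : Submodule R ((ℕ →₀ R) × M), IsComplemented N → IsDirectSumFG R N) :
    IsLocalRing (integralClosure R Q) := by
  refine IsLocalRing.of_isUnit_or_isUnit_one_sub_self fun α => ?_
  by_contra! hα
  obtain ⟨P₀, hP₀, hα₀⟩ := exists_max_ideal_of_mem_nonunits hα.1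
  obtain ⟨P₁, hP₁, hα₁⟩ := exists_max_ideal_of_mem_nonunits hα.2
  obtain ⟨S, hSV, hαS, hfin, -, r, hr, hrm, hrS⟩ := exists_finite_subalgebra hR
    (integralClosure R Q) (fun x hx => hx) {(α : Q)} (Set.finite_singleton _)
    (Set.singleton_subset_iff.mpr α.2)
  have hinj : Function.Injective (algebraMap R S) := fun x y hxy =>
    IsFractionRing.injective R Q (congrArg Subtype.val hxy)
  let β : S := ⟨α, hαS rfl⟩
  obtain ⟨t, w, y, z, h1, h2⟩ := IsIntegral.exists_idempotent_mod
    (Algebra.IsIntegral.isIntegral (R := R) β) hr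
  set a := Polynomial.aeval β t * β
  let := Ideal.Quotient.field P₀
  let := Ideal.Quotient.field P₁
  let ι := (Subalgebra.inclusion hSV).toRingHom
  let ψ : ∀ P : Ideal (integralClosure R Q), S →+* integralClosure R Q ⧸ P :=
    fun P => (Ideal.Quotient.mk P).comp ι
  have hψ : ∀ (P : Ideal (integralClosure R Q)), P.IsMaximal → ∀ r, ¬ IsUnit r →
      ψ P (algebraMap R S r) = 0 := by
    intro P hP r hr
    refine Ideal.Quotient.eq_zero_iff_mem.mpr ?_
    have := IsLocalRing.eq_maximalIdeal
      (Ideal.isMaximal_comap_of_isIntegral_of_isMaximal (R := R) P)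
    have h3 : r ∈ P.comap (algebraMap R (integralClosure R Q)) := by
      rw [this]
      exact hr
    exact h3
  have ha₀ : ψ P₀ a = 0 := by
    rw [map_mul, show ψ P₀ β = 0 from Ideal.Quotient.eq_zero_iff_mem.mpr hα₀, mul_zero]
  have ha₁ : ψ P₁ a = 1 := by
    have h3 := congrArg (ψ P₁) h2
    rw [Algebra.smul_def, map_mul (ψ P₁) (algebraMap R S r), hψ P₁ hP₁ r hrm, zero_mul, map_sub,
      map_mul, show ψ P₁ (1 - β) = 0 from Ideal.Quotient.eq_zero_iff_mem.mpr hα₁, mul_zero, sub_zero,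
      map_sub, map_one, sub_eq_zero] at h3
    exact h3.symm
  have hc₁ : ∀ y : S, ∃ x : R, algebraMap R S x = r • y := fun y => by
    obtain ⟨x, hx⟩ := hrS y y.2
    exact ⟨x, Subtype.ext hx⟩
  obtain ⟨c, hc⟩ := hc₁ y
  have hca : algebraMap R S c = a ^ 2 - a := by rw [hc, ← h1, sq]
  have hcS : ∀ y' : S, ∃ x : R, algebraMap R S x = algebraMap R S c * y' := fun y' => by
    obtain ⟨x, hx⟩ := hc₁ (y * y')
    exact ⟨x, by rw [hx, hc, smul_mul_assoc]⟩
  -- Being 0 at P₀ and 1 at P₁, a is neither 1 nor 0, so a² - a is nonzero in the domain S.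
  have hc0 : algebraMap R S c ≠ 0 := by
    rw [hca, sq, sub_ne_zero, ne_eq, mul_eq_left₀]
    · intro h3
      rw [h3, map_one] at ha₀
      exact one_ne_zero ha₀
    · intro h3
      rw [h3, map_zero] at ha₁
      exact zero_ne_one ha₁
  obtain ⟨E, hE, hEa⟩ := exists_idempotent_end_finsupp_prod hca hcS hinj
  refine not_isDirectSumFG_range hc0 hcS (ψ P₀) (ψ P₁) (hψ P₀ hP₀) (hψ P₁ hP₁) hE
    (by rw [hEa, ha₀]) (by rw [hEa, ha₁]) ?_
  exact h S hfin inferInstance (S.finrank_eq_one_of_smul_mem hr hrS) _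
    ⟨_, LinearMap.IsIdempotentElem.isCompl hE⟩

end Implications

theorem ringKrullDim_eq_one_imp {R : Type*} [CommRing R] [IsDomain R]
    (h : ringKrullDim R = 1) : Ring.DimensionLEOne R ∧ ¬ IsField R :=
  ⟨⟨fun hp hprime => Ring.krullDimLE_one_iff_of_noZeroDivisors.mp
      (Ring.krullDimLE_iff.mpr (by simp [h])) _ hp hprime⟩,
    fun hF => zero_ne_one ((ringKrullDim_eq_zero_of_isField hF) ▸ h)⟩

theorem mainTheorem2 (R : Type u) [CommRing R] [IsDomain R] [IsLocalRing R]
    (hdim : ringKrullDim R = 1)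
    (Q : Type v) [Field Q] [Algebra R Q] [IsFractionRing R Q] :
    -- if the integral closure is a valuation ring, every finitely generated torsion-free module
    -- is a direct sum of modules with local endomorphism ring
    (ValuationRing (integralClosure R Q) →
      ∀ (M : Type u) [AddCommGroup M] [Module R M],
        Module.Finite R M → Module.IsTorsionFree R M → IsDirectSumLocalEnd R M) ∧
    (IsNoetherianRing R →
      List.TFAE [
        -- (1)
        ∀ (M : Type u) [AddCommGroup M] [Module R M], IsDirectSumFGTorsionFreeRankOne R M →
          ∀ N : Submodule R M, IsComplemented N → IsDirectSumFG R N,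
        -- (1')
        ∀ (M : Type u) [AddCommGroup M] [Module R M], IsDirectSumFGTorsionFreeRankOne R M →
          ∀ N : Submodule R M, IsComplemented N → IsDirectSumFGTorsionFreeRankOne R N,
        -- (2)
        ∀ (M : Type u) [AddCommGroup M] [Module R M],
          Module.Finite R M → Module.IsTorsionFree R M → Module.finrank R M = 1 →
          ∀ N : Submodule R ((ℕ →₀ R) × M), IsComplemented N → IsDirectSumFG R N,
        -- (3)
        ∀ (M : Type u) [AddCommGroup M] [Module R M],
          Module.Finite R M → Module.IsTorsionFree R M → Module.finrank R M = 1 →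
          IsLocalRing (Module.End R M),
        -- (4)
        IsLocalRing (integralClosure R Q),
        -- (4')
        IsDiscreteValuationRing (integralClosure R Q),
        -- (5)
        ∀ (M : Type u) [AddCommGroup M] [Module R M], IsDirectSumFGTorsionFree R M →
          ∀ N : Submodule R M, IsComplemented N → IsDirectSumFG R N,
        -- (5')
        ∀ (M : Type u) [AddCommGroup M] [Module R M], IsDirectSumFGTorsionFree R M →
          ∀ N : Submodule R M, IsComplemented N → IsDirectSumFGTorsionFree R N,
        -- (6)
        ∀ (M : Type u) [AddCommGroup M] [Module R M],
          Module.Finite R M → Module.IsTorsionFree R M →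
          ∀ N : Submodule R ((ℕ →₀ R) × M), IsComplemented N → IsDirectSumFG R N,
        -- (7)
        ∀ (M : Type u) [AddCommGroup M] [Module R M],
          Module.Finite R M → Module.IsTorsionFree R M → IsIndecomposableModule R M →
          IsLocalRing (Module.End R M)]) := by
  obtain ⟨hdim1, hR⟩ := ringKrullDim_eq_one_imp hdim
  have hex : ValuationRing (integralClosure R Q) → ∀ (M : Type u) [AddCommGroup M] [Module R M]
      [Module.Finite R M] [Module.IsTorsionFree R M], IsExchangeRing (Module.End R M) :=
    fun hV M => isExchangeRing_end_of_valuationRing hR hV M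
  refine ⟨fun hV M _ _ _ _ => isDirectSumLocalEnd_of_exchange M fun B _ => hex hV B, fun hN => ?_⟩
  -- The converse lemmas need the fraction field in the universe of R, since the test modules are
  -- subalgebras of it. They are applied to `FractionRing R` and the result is transported to Q.
  have hloc : IsLocalRing (integralClosure R (FractionRing R)) →
      IsLocalRing (integralClosure R Q) := fun h =>
    ((IsLocalization.algEquiv (nonZeroDivisors R) (FractionRing R)
      Q).mapIntegralClosure.toRingEquiv).isLocalRing
  -- Numbers are positions in the list: 5 is locality of the integral closure, 6 the discrete
  -- valuation property. The latter gives exchange and hence 2, 8 and 10; every route leads back to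
  -- 5 through 3 or 4.
  tfae_have 1 → 3 := fun h M _ _ h1 h2 h3 =>
    h _ (isDirectSumFGTorsionFreeRankOne_finsupp_prod M h3)
  tfae_have 2 → 1 := fun h M _ _ hM N hN => (h M hM N hN).mono fun _ hL => hL.1
  tfae_have 3 → 5 := fun h => hloc (isLocalRing_integralClosure_of_isDirectSumFG hR h)
  tfae_have 4 → 5 := fun h => hloc (isLocalRing_integralClosure_of_isLocalRing_end hR h)
  tfae_have 5 → 6 := isDiscreteValuationRing_integralClosure hR
  tfae_have 6 → 5 := fun h => inferInstance
  tfae_have 6 → 2 := fun h M _ _ hM => hM.of_isComplemented (hex inferInstance)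
  tfae_have 6 → 8 := fun h M _ _ hM => hM.of_isComplemented (hex inferInstance)
  tfae_have 6 → 10 := fun h M _ _ _ _ hM => hM.isLocalRing_end (hex inferInstance M)
  tfae_have 10 → 4 := fun h M _ _ h1 h2 h3 =>
    h M h1 h2 (isIndecomposableModule_of_finrank_eq_one M h3)
  tfae_have 8 → 7 := fun h M _ _ hM N hN => (h M hM N hN).mono fun _ hL => hL.1
  tfae_have 7 → 9 := fun h M _ _ h1 h2 => h _ (isDirectSumFGTorsionFree_finsupp_prod M)
  tfae_have 9 → 3 := fun h M _ _ h1 h2 h3 => h M h1 h2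
  tfae_finish
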